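/- Functions of $\lambda\in\mathbb R\cup i\mathbb R$ are viewed as functions of $z=\lambda^2\in\mathbb R$ on each of the two sets $\mathbb R^+\cup i\mathbb R^+$ and $\mathbb R^-\cup i\mathbb R^-$ (up to the point $\lambda=0$, $\lambda\mapsto z$ maps each of them bijectively onto $\mathbb R$); $L^p_z$ is the corresponding $L^p$ space with respect to $|dz|$, and "almost every $\lambda$" refers to $|dz|$. Let $\mathcal C(h)(\zeta)=\frac1{2\pi i}\int_{\mathbb R}\frac{h(s)}{s-\zeta}\,ds$ and $\mathcal P^-(h)(z)=\lim_{\epsilon\downarrow0}\mathcal C(h)(z-i\epsilon)$, $z\in\mathbb R$; for functions of $\lambda$, $\mathcal P^-$ acts in the variable $z$ on each of the two sets. For $x\in\mathbb R$ and $r:\mathbb R\cup i\mathbb R\to\mathbb C$ put $$S(x;\lambda)=\begin{pmatrix}|r(\lambda)|^2&\overline{r(\lambda)}e^{-2i\lambda^2x}\\ r(\lambda)e^{2i\lambda^2x}&0\end{pmatrix}\ (\lambda\in\mathbb R),\qquad S(x;\lambda)=\begin{pmatrix}-|r(\lambda)|^2&-\overline{r(\lambda)}e^{-2i\lambda^2x}\\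 r(\lambda)e^{2i\lambda^2x}&0\end{pmatrix}\ (\lambda\in i\mathbb R\setminus\{0\}).$$ Consider the condition $$(\ast)\qquad 1-|r(\lambda)|^2\ge c_0^2>0\quad\text{for almost every }\lambda\in i\mathbb R,\text{ for some constant }c_0 .$$ (a) Let $r\in L^2_z\cap L^\infty_z$ satisfy $(\ast)$. Then for every $x\in\mathbb R$ and every matrix function $F\in L^2_z$ with two columns (and any finite number of rows), there is a solution $G\in L^2_z$ of $$G-\mathcal P^-(G\,S(x;\cdot))=F\quad\text{a.e. on }\mathbb R\cup i\mathbb R$$ (the limits defining $\mathcal P^-(GS)$ existing almost everywhere), and it is unique up to equality almost everywhere. (b) Let $r_\pm\in H^1(\mathbb R)\cap L^{2,1}(\mathbb R)$, where $L^{2,1}(\mathbb R)=\{f:(1+z^2)^{1/2}f\in L^2(\mathbb R)\}$, satisfy $r_-(z)=4z\,r_+(z)$ for a.e. $z$, and suppose that $r(\lambda):=-2i\lambda\,r_+(\lambda^2)$ satisfies $(\ast)$. Let $\tau_1(\lambda)=\mathrm{diag}(1,2i\lambda)$ and $\tau_2(\lambda)=\mathrm{diag}((2i\lambda)^{-1},1)$.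 Then for every $x\in\mathbb R$ and $j\in\{1,2\}$ there is exactly one pair $(G_+,G_-)$ of $2\times2$ matrix functions, $G_\pm$ analytic in $z\in\mathbb C^\pm$, such that: * $G_\pm$ is of class $L^2_z$ in the Hardy sense: $\sup_{y>0}\|G_\pm(\cdot\pm iy)\|_{L^2(\mathbb R)}<\infty$, and $G_\pm$ has nontangential boundary values almost everywhere on $\mathbb R$, which belong to $L^2(\mathbb R)$; * $G_\pm\to0$ as $|z|\to\infty$ within every half plane $\{\pm\mathrm{Im}\,z\ge\delta\}$, $\delta>0$; * for almost every $\lambda\in\mathbb R\cup i\mathbb R$, $$G_+(\lambda)-G_-(\lambda)=G_-(\lambda)S(x;\lambda)+\tau_j(\lambda)S(x;\lambda),$$ where for $\lambda\in\mathbb R^+\cup i\mathbb R^+$ the values $G_\pm(\lambda)$ are the boundary values at $z=\lambda^2$, extended to $\mathbb R^-\cup i\mathbb R^-$ by parity: for $j=1$ the first column is even and the second odd in $\lambda$, for $j=2$ the first column is odd and the second even. -/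

import Mathlib

open MeasureTheory Filter Topology
open scoped ENNReal NNReal ComplexConjugate SchwartzMap

noncomputable section

namespace KaupNewell

/-- The point `lam` of the cross `ℝ ∪ iℝ` with `lam ^ 2 = z` lying over the real point `z`.
For `s = 1` it lies on `ℝ⁺ ∪ iℝ⁺`, for `s = -1` on `ℝ⁻ ∪ iℝ⁻`. -/
def branch (s : ℤˣ) (z : ℝ) : ℂ :=
  ((s : ℤ) : ℂ) * (if 0 ≤ z then ((√z : ℝ) : ℂ) else Complex.I * ((√(-z) : ℝ) : ℂ))

/-- A property holds at almost every point of the cross `ℝ ∪ iℝ`, with respect to `|dz|`,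
`z = lam ^ 2`. -/
def AEOnCross (P : ℂ → Prop) : Prop :=
  ∀ s : ℤˣ, ∀ᵐ z : ℝ, P (branch s z)

/-- The space `L^p_z` of functions on the cross `ℝ ∪ iℝ`: `p`-integrability with respect to `|dz|`,
`z = lam ^ 2`. -/
def MemLpz (p : ℝ≥0∞) (f : ℂ → ℂ) : Prop :=
  ∀ s : ℤˣ, MemLp (fun z : ℝ => f (branch s z)) p volume

/-- The space `L^2_z` of matrix functions on the cross. -/
def MatMemL2z {m n : ℕ} (F : ℂ → Matrix (Fin m) (Fin n) ℂ) : Prop :=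
  ∀ i j, MemLpz 2 (fun lam => F lam i j)

/-- The constraint `1 - |r(lam)| ^ 2 ≥ c₀ ^ 2 > 0` for `lam ∈ iℝ`. -/
def StrictlyContractive (r : ℂ → ℂ) : Prop :=
  ∃ c₀ : ℝ, 0 < c₀ ∧ AEOnCross (fun lam => lam.re = 0 → c₀ ^ 2 ≤ 1 - ‖r lam‖ ^ 2)

/-- The scattering matrix `S(x; lam)`: Hermitian for `lam ∈ ℝ`, not Hermitian for
`lam ∈ iℝ`. -/
def S (x : ℝ) (r : ℂ → ℂ) (lam : ℂ) : Matrix (Fin 2) (Fin 2) ℂ :=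
  if lam.im = 0 then
    !![((‖r lam‖ ^ 2 : ℝ) : ℂ), conj (r lam) * Complex.exp (-2 * Complex.I * lam ^ 2 * x);
       r lam * Complex.exp (2 * Complex.I * lam ^ 2 * x), 0]
  else
    !![-((‖r lam‖ ^ 2 : ℝ) : ℂ), -conj (r lam) * Complex.exp (-2 * Complex.I * lam ^ 2 * x);
       r lam * Complex.exp (2 * Complex.I * lam ^ 2 * x), 0]

/-- The Cauchy operator `𝒞(h)(ζ)`. -/
def cauchy (h : ℝ → ℂ) (ζ : ℂ) : ℂ :=
  (2 * Real.pi * Complex.I)⁻¹ * ∫ t : ℝ, h t / ((t : ℂ) - ζ)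

/-- `𝒫⁻(h) = k` almost everywhere: the limits defining the Plemelj projection `𝒫⁻(h)` exist at
almost every `z` and equal `k z`. -/
def HasProjMinus (h k : ℝ → ℂ) : Prop :=
  ∀ᵐ z : ℝ, Tendsto (fun ε : ℝ => cauchy h ((z : ℂ) - ε * Complex.I)) (𝓝[>] 0) (𝓝 (k z))

/-- `(I - 𝒫⁻_S) G = F` on `ℝ ∪ iℝ`, where `𝒫⁻_S G = 𝒫⁻(G S)`; that is, `𝒫⁻(G S)` exists and equals
`G - F`. The projection is taken in the variable `z = lam ^ 2`, on each of `ℝ⁺ ∪ iℝ⁺` and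
`ℝ⁻ ∪ iℝ⁻`; for functions even or odd in `lam` this is the extension by parity. -/
def SolvesIntegralEq {m : ℕ} (x : ℝ) (r : ℂ → ℂ) (F G : ℂ → Matrix (Fin m) (Fin 2) ℂ) : Prop :=
  ∀ (s : ℤˣ) (i : Fin m) (j : Fin 2),
    HasProjMinus (fun t => (G (branch s t) * S x r (branch s t)) i j)
      (fun z => (G (branch s z) - F (branch s z)) i j)

/-- The Sobolev space `H^1(ℝ)`. -/
def MemH1 (f : ℝ → ℂ) : Prop :=
  ∃ hf : MemLp f 2 (volume : Measure ℝ),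
    TemperedDistribution.MemSobolev 1 2 ((hf.toLp f : Lp ℂ 2 (volume : Measure ℝ)) : 𝓢'(ℝ, ℂ))

/-- The weighted space `L^{2,1}(ℝ)`, with weight `⟨z⟩ = (1 + z ^ 2) ^ (1 / 2)`. -/
def MemL21 (f : ℝ → ℂ) : Prop :=
  MemLp (fun z : ℝ => ((√(1 + z ^ 2) : ℝ) : ℂ) * f z) 2 volume

/-- The reflection coefficient `r(lam)` on the cross given by the scattering datum `r₊`, i.e. the
solution of `r₊(z) = - r(lam) / (2 i lam)`, `z = lam ^ 2`. -/
def reflection (rp : ℝ → ℂ) (lam : ℂ) : ℂ :=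
  -(2 * Complex.I * lam) * rp (lam ^ 2).re

/-- The diagonal matrices `τ₁` (index `0`) and `τ₂` (index `1`). -/
def tau (j : Fin 2) (lam : ℂ) : Matrix (Fin 2) (Fin 2) ℂ :=
  if j = 0 then !![1, 0; 0, 2 * Complex.I * lam] else !![(2 * Complex.I * lam)⁻¹, 0; 0, 1]

/-- The parity of the columns: for the first problem the first column is even and the second odd in
`lam`, for the second problem the first column is odd and the second even. If `g z` is the value at
`branch 1 z`, then `g z * parity j s` is the value at `branch s z`. -/
def parity (j : Fin 2) (s : ℤˣ) : Matrix (Fin 2) (Fin 2) ℂ :=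
  if j = 0 then !![1, 0; 0, ((s : ℤ) : ℂ)] else !![((s : ℤ) : ℂ), 0; 0, 1]

/-- The open half plane `ℂ⁺` for `s = 1`, `ℂ⁻` for `s = -1`. -/
def halfPlane (s : ℤˣ) : Set ℂ := {ζ | 0 < ((s : ℤ) : ℝ) * ζ.im}

/-- The nontangential approach region of aperture `k` at `t ∈ ℝ` from `halfPlane s`. -/
def cone (s : ℤˣ) (k t : ℝ) : Set ℂ :=
  {ζ | 0 < ((s : ℤ) : ℝ) * ζ.im ∧ |ζ.re - t| ≤ k * (((s : ℤ) : ℝ) * ζ.im)}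

/-- `f` is analytic in the half plane `ℂ^±`, is there uniformly `L^2` on horizontal lines (the Hardy
class), tends to zero at infinity within each smaller half plane `|Im ζ| ≥ δ`, and has
the nontangential boundary values `g ∈ L^2(ℝ)` almost everywhere. -/
structure IsHardy (s : ℤˣ) (f : ℂ → ℂ) (g : ℝ → ℂ) : Prop where
  analytic : DifferentiableOn ℂ f (halfPlane s)
  bounded : ∃ C : ℝ≥0, ∀ y : ℝ, 0 < y →
    eLpNorm (fun t : ℝ => f ((t : ℂ) + ((s : ℤ) : ℂ) * y * Complex.I)) 2 volume ≤ C
  decay : ∀ δ : ℝ, 0 < δ →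
    Tendsto f (Bornology.cobounded ℂ ⊓ 𝓟 {ζ | δ ≤ ((s : ℤ) : ℝ) * ζ.im}) (𝓝 0)
  boundary_memLp : MemLp g 2 volume
  boundary : ∀ᵐ t : ℝ, ∀ k : ℝ, Tendsto f (𝓝[cone s k t] (t : ℂ)) (𝓝 (g t))

/-- `(G₊, G₋)` solves the `j`-th Riemann--Hilbert problem
`G₊ - G₋ = G₋ S + τ_j S` on `ℝ ∪ iℝ`, `G_± → 0` at infinity, in the class of functions that are
analytic in `z = lam ^ 2 ∈ ℂ^±` and in `L^2_z`, with columns of the parity prescribed by `j`. -/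
def IsRHSolution (j : Fin 2) (x : ℝ) (r : ℂ → ℂ) (Gp Gm : ℂ → Matrix (Fin 2) (Fin 2) ℂ) : Prop :=
  ∃ gp gm : ℝ → Matrix (Fin 2) (Fin 2) ℂ,
    (∀ a b, IsHardy 1 (fun ζ => Gp ζ a b) (fun z => gp z a b)) ∧
    (∀ a b, IsHardy (-1) (fun ζ => Gm ζ a b) (fun z => gm z a b)) ∧
    ∀ s : ℤˣ, ∀ᵐ z : ℝ,
      gp z * parity j s - gm z * parity j s =
        gm z * parity j s * S x r (branch s z) + tau j (branch s z) * S x r (branch s z)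

end KaupNewell

end

open MeasureTheory Filter Topology
open scoped ENNReal NNReal ComplexConjugate SchwartzMap

noncomputable section

namespace KaupNewell

/-! On `L²(ℝ)` the operator `-𝒫⁻` is an orthogonal projection `Q`, namely `projLower`: the Cauchy
kernels with poles below the axis span a closed subspace, and the Cauchy integral of its elements
vanishes below the axis, that of the elements of its complement above it. Since the jump of a Cauchy
integral is a Poisson integral, Fatou's theorem identifies the boundary values (`hasProjMinus_iff`).

The equation for one row on one sheet thus reads `u + Q(A u) = f`, with `A` multiplication by `S`
from the right. Everything rests on the pointwise coercivity `Re ⟨v, v + v S⟩ ≥ c |v|²`. On the real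
axis `I + S` is Hermitian and the form is a sum of two squares, positive without any smallness of
`r`. On the imaginary axis the off-diagonal terms are purely imaginary and leave `(1 - |r|²)|a|² +
|b|²`, which is where `(∗)` enters (`exists_rowCoercive_S`). Coercivity of `I + A` gives injectivity
of `I + QA` at once, and surjectivity through Lax–Milgram for `I + QAQ`. This is (a).

For (b), oddness of `r` reduces both sheets to one. A solution pair is the Cauchy integral of its
jump `d = G₋S + τS`, so the problem is equivalent to `G₋ = 𝒫⁻(G₋S) + 𝒫⁻(τS)` on the line, the
equation of (a) with `F = 𝒫⁻(τS)`. The data enter through `|r|² = |r₋||r₊|`, `|2iλ r| = |r₋|` and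
`|r / (2iλ)| = |r₊|`, which put `r` in `L^∞` and `τS` in `L²`. Passing from the Riemann–Hilbert
problem back to the line uses Cauchy's formula for the Hardy class. -/

/-! ### Poisson integrals of `L²` functions and Fatou's theorem. -/

/-- The Poisson kernel of the upper half plane at the point `ζ`. -/
def halfPlanePoisson (ζ : ℂ) (t : ℝ) : ℝ :=
  Real.pi⁻¹ * (ζ.im / ((t - ζ.re) ^ 2 + ζ.im ^ 2))

lemma div_sq_add_sq_eq {y : ℝ} (hy : y ≠ 0) (u : ℝ) :
    y / (u ^ 2 + y ^ 2) = y⁻¹ * (1 + (u / y) ^ 2)⁻¹ := by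
  have : u ^ 2 + y ^ 2 ≠ 0 := by positivity
  have : (1 + (u / y) ^ 2) ≠ 0 := by positivity
  field_simp
  ring

lemma integrable_div_sq_add_sq (x : ℝ) {y : ℝ} (hy : y ≠ 0) :
    Integrable (fun t : ℝ => y / ((t - x) ^ 2 + y ^ 2)) := by
  have h := ((integrable_inv_one_add_sq.comp_div hy).comp_sub_right x).const_mul y⁻¹
  refine h.congr (Eventually.of_forall fun t => ?_)
  simp only [div_sq_add_sq_eq hy]

lemma integral_div_sq_add_sq (x : ℝ) {y : ℝ} (hy : 0 < y) :
    ∫ t : ℝ, y / ((t - x) ^ 2 + y ^ 2) = Real.pi := by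
  rw [integral_sub_right_eq_self (fun t : ℝ => y / (t ^ 2 + y ^ 2)) x]
  simp_rw [div_sq_add_sq_eq hy.ne']
  rw [integral_const_mul, Measure.integral_comp_div (fun t : ℝ => (1 + t ^ 2)⁻¹) y,
    integral_univ_inv_one_add_sq, abs_of_pos hy, smul_eq_mul]
  field_simp

lemma halfPlanePoisson_nonneg {ζ : ℂ} (hζ : 0 < ζ.im) (t : ℝ) : 0 ≤ halfPlanePoisson ζ t := by
  unfold halfPlanePoisson
  positivity

lemma continuous_halfPlanePoisson {ζ : ℂ} (hζ : 0 < ζ.im) : Continuous (halfPlanePoisson ζ) := by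
  unfold halfPlanePoisson
  refine continuous_const.mul (continuous_const.div (by fun_prop) fun t => ?_)
  positivity

lemma integrable_halfPlanePoisson {ζ : ℂ} (hζ : 0 < ζ.im) : Integrable (halfPlanePoisson ζ) :=
  (integrable_div_sq_add_sq _ hζ.ne').const_mul _

lemma integral_halfPlanePoisson {ζ : ℂ} (hζ : 0 < ζ.im) : ∫ t, halfPlanePoisson ζ t = 1 := by
  unfold halfPlanePoisson
  rw [integral_const_mul, integral_div_sq_add_sq _ hζ, inv_mul_cancel₀ Real.pi_ne_zero]

lemma lintegral_halfPlanePoisson {ζ : ℂ} (hζ : 0 < ζ.im) :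
    ∫⁻ t, ENNReal.ofReal (halfPlanePoisson ζ t) = 1 := by
  rw [← ofReal_integral_eq_lintegral_ofReal (integrable_halfPlanePoisson hζ)
    (Eventually.of_forall (halfPlanePoisson_nonneg hζ)), integral_halfPlanePoisson hζ,
    ENNReal.ofReal_one]

/-- The Poisson integral of `p`. -/
def poissonIntegral (p : ℝ → ℂ) (ζ : ℂ) : ℂ := ∫ t, (halfPlanePoisson ζ t : ℂ) * p t

/-- The Poisson kernel is dominated by a dyadic sum of normalised indicator functions. -/
lemma div_sq_add_sq_le_tsum {y : ℝ} (hy : 0 < y) (t s : ℝ) :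
    ENNReal.ofReal (y / ((s - t) ^ 2 + y ^ 2)) ≤
      ∑' k : ℕ, ENNReal.ofReal (4 * (1 / 4) ^ k / y) *
        (Metric.closedBall t (2 ^ k * y)).indicator 1 s := by
  classical
  have hex : ∃ k : ℕ, |s - t| ≤ 2 ^ k * y := by
    obtain ⟨k, hk⟩ := pow_unbounded_of_one_lt (|s - t| / y) (one_lt_two)
    exact ⟨k, by rw [div_lt_iff₀ hy] at hk; exact hk.le⟩
  -- One term suffices, that of the smallest `k` with `|s - t| ≤ 2 ^ k * y`: for `k > 0` minimality
  -- gives `|s - t| > 2 ^ (k - 1) * y`, so the kernel is at most `4 * 4 ^ (-k) / y`.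
  refine le_trans ?_ (ENNReal.le_tsum (Nat.find hex))
  have h1 := Nat.find_spec hex
  rw [Set.indicator_of_mem (by rw [Metric.mem_closedBall, Real.dist_eq]; exact h1)]
  rw [Pi.one_apply, mul_one]
  refine ENNReal.ofReal_le_ofReal ?_
  rcases hk : Nat.find hex with _ | j
  · rw [pow_zero, mul_one, div_le_div_iff₀ (by positivity) hy]
    nlinarith [sq_nonneg (s - t)]
  · have h2 : 2 ^ j * y < |s - t| := by
      have := Nat.find_min hex (m := j) (by omega)
      push Not at this
      exact this
    have h3 : (2 ^ j * y) ^ 2 ≤ (s - t) ^ 2 := by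
      rw [← sq_abs (s - t)]
      exact pow_le_pow_left₀ (by positivity) h2.le 2
    have h4 : (4 : ℝ) * (1 / 4) ^ (j + 1) / y = y / (2 ^ j * y) ^ 2 := by
      have : ((2 : ℝ) ^ j) ^ 2 = 4 ^ j := by rw [← pow_mul, mul_comm, pow_mul]; norm_num
      rw [mul_pow, this, pow_succ, one_div, inv_pow]
      field_simp
    rw [h4]
    exact div_le_div_of_nonneg_left hy.le (by positivity) (by nlinarith [sq_nonneg y])

/-- The `k`-th ball contributes at most `4 * 4 ^ (-k) / y` times `C * 2 ^ k * y`, and these sum to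
`8 * C`. The bound is uniform in `y` and replaces a maximal function estimate. -/
lemma lintegral_div_sq_add_sq_mul_le {g : ℝ → ℝ≥0∞} (hg : AEMeasurable g) {t C : ℝ}
    (hC : 0 ≤ C) (h : ∀ r : ℝ, 0 < r → ∫⁻ s in Metric.closedBall t r, g s ≤ ENNReal.ofReal (C * r))
    {y : ℝ} (hy : 0 < y) :
    ∫⁻ s, ENNReal.ofReal (y / ((s - t) ^ 2 + y ^ 2)) * g s ≤ ENNReal.ofReal (8 * C) := by
  have hm : ∀ k : ℕ, AEMeasurable (fun s : ℝ => ENNReal.ofReal (4 * (1 / 4) ^ k / y) *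
        (Metric.closedBall t (2 ^ k * y)).indicator 1 s * g s) := fun k =>
    (((measurable_one.indicator Metric.isClosed_closedBall.measurableSet).aemeasurable).const_mul
      _).mul hg
  calc ∫⁻ s, ENNReal.ofReal (y / ((s - t) ^ 2 + y ^ 2)) * g s
      ≤ ∫⁻ s, ∑' k : ℕ, ENNReal.ofReal (4 * (1 / 4) ^ k / y) *
        (Metric.closedBall t (2 ^ k * y)).indicator 1 s * g s := by
        refine lintegral_mono fun s => ?_
        rw [ENNReal.tsum_mul_right]
        gcongr
        exact div_sq_add_sq_le_tsum hy t s
    _ = ∑' k : ℕ, ENNReal.ofReal (4 * (1 / 4) ^ k / y) *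
          ∫⁻ s in Metric.closedBall t (2 ^ k * y), g s := by
        rw [lintegral_tsum hm]
        congr 1 with k
        rw [← lintegral_indicator Metric.isClosed_closedBall.measurableSet,
          ← lintegral_const_mul'' _ (hg.indicator Metric.isClosed_closedBall.measurableSet)]
        congr 1 with s
        by_cases hs : s ∈ Metric.closedBall t (2 ^ k * y) <;> simp [hs]
    _ ≤ ∑' k : ℕ, ENNReal.ofReal (4 * C * (1 / 2) ^ k) := by
        refine ENNReal.tsum_le_tsum fun k => ?_
        calc _ ≤ ENNReal.ofReal (4 * (1 / 4) ^ k / y) * ENNReal.ofReal (C * (2 ^ k * y)) := by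
              gcongr
              exact h _ (by positivity)
          _ = ENNReal.ofReal (4 * C * (1 / 2) ^ k) := by
              rw [← ENNReal.ofReal_mul (by positivity)]
              congr 1
              have : (1 / 4 : ℝ) ^ k * 2 ^ k = (1 / 2) ^ k := by rw [← mul_pow]; norm_num
              rw [← this]
              field_simp
    _ = ENNReal.ofReal (8 * C) := by
        rw [← ENNReal.ofReal_tsum_of_nonneg (fun k => by positivity)
          (summable_geometric_two.mul_left _), tsum_mul_left, tsum_geometric_two]
        congr 1
        ring

/-- The kernel of height one lies in `L¹ ∩ L²`, so it pairs with both `p` and the constant. This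
controls the part of the Poisson integral far from `t`. -/
lemma lintegral_inv_sq_add_one_mul_enorm_lt_top {p : ℝ → ℂ} (hp : MemLp p 2) (t : ℝ) (c : ℂ) :
    ∫⁻ s, ENNReal.ofReal (((s - t) ^ 2 + 1)⁻¹) * ‖p s - c‖ₑ < ∞ := by
  have hi : Integrable (fun s : ℝ => ((s - t) ^ 2 + 1)⁻¹) := by
    simpa using integrable_div_sq_add_sq t (one_ne_zero)
  have hk : MemLp (fun s : ℝ => ((((s - t) ^ 2 + 1)⁻¹ : ℝ) : ℂ)) 2 := by
    have hm : AEStronglyMeasurable (fun s : ℝ => ((((s - t) ^ 2 + 1)⁻¹ : ℝ) : ℂ)) :=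
      (Complex.continuous_ofReal.comp_aestronglyMeasurable hi.1)
    rw [memLp_two_iff_integrable_sq_norm hm]
    refine hi.mono' (hm.norm.pow 2) (Eventually.of_forall fun s => ?_)
    have h1 : 0 ≤ ((s - t) ^ 2 + 1)⁻¹ := by positivity
    have h2 : ((s - t) ^ 2 + 1)⁻¹ ≤ 1 := inv_le_one_of_one_le₀ (by nlinarith [sq_nonneg (s - t)])
    simp only [Complex.norm_real, Real.norm_eq_abs, abs_pow, abs_of_nonneg h1]
    nlinarith
  have h : Integrable (fun s : ℝ => ((((s - t) ^ 2 + 1)⁻¹ : ℝ) : ℂ) * (p s - c)) := by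
    have h1 := (hk.integrable_mul hp).sub (hi.ofReal.mul_const c (𝕜 := ℂ))
    refine h1.congr (Eventually.of_forall fun s => ?_)
    simp [mul_sub]
  refine lt_of_eq_of_lt (lintegral_congr fun s => ?_) h.2
  rw [enorm_mul, ← ofReal_norm (E := ℂ) (((s - t) ^ 2 + 1)⁻¹ : ℝ), Complex.norm_real,
    Real.norm_eq_abs, abs_of_nonneg (by positivity)]

/-- Approximation of the identity by the Poisson kernel at a Lebesgue point. -/
lemma tendsto_lintegral_poisson_of_lebesgue {p : ℝ → ℂ} (hp : MemLp p 2) {t : ℝ}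
    (ht : Tendsto (fun r : ℝ => ⨍ s in Metric.closedBall t r, ‖p s - p t‖) (𝓝[>] 0) (𝓝 0)) :
    Tendsto (fun y : ℝ => ∫⁻ s, ENNReal.ofReal (y / ((s - t) ^ 2 + y ^ 2)) * ‖p s - p t‖ₑ)
      (𝓝[>] 0) (𝓝 0) := by
  have hmeas : AEMeasurable (fun s => ‖p s - p t‖ₑ) :=
    (hp.1.sub aestronglyMeasurable_const).enorm
  have hloc : LocallyIntegrable (fun s => p s - p t) :=
    (hp.locallyIntegrable (by norm_num)).sub (locallyIntegrable_const _)
  rw [ENNReal.tendsto_nhds_zero]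
  intro ε hε
  obtain ⟨δ, hδ0, hδε⟩ : ∃ δ : ℝ, 0 < δ ∧ ENNReal.ofReal (8 * (2 * δ)) ≤ ε / 2 := by
    rcases eq_or_ne ε ∞ with rfl | hfin
    · exact ⟨1, one_pos, by simp [ENNReal.top_div_of_ne_top]⟩
    · refine ⟨ε.toReal / 32, div_pos (ENNReal.toReal_pos hε.ne' hfin) (by norm_num), ?_⟩
      rw [ENNReal.ofReal_le_iff_le_toReal (ENNReal.div_lt_top hfin (by norm_num)).ne]
      rw [ENNReal.toReal_div]
      norm_num
      linarith [ENNReal.toReal_nonneg (a := ε)]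
  have hball : ∀ᶠ r in 𝓝[>] (0 : ℝ),
      ∫⁻ s in Metric.closedBall t r, ‖p s - p t‖ₑ ≤ ENNReal.ofReal (2 * δ * r) := by
    filter_upwards [ht.eventually (gt_mem_nhds hδ0), self_mem_nhdsWithin] with r hr hr0
    have hr0 : 0 < r := hr0
    rw [setAverage_eq, Measure.real, Real.volume_closedBall, ENNReal.toReal_ofReal (by positivity),
      smul_eq_mul, inv_mul_lt_iff₀ (by positivity)] at hr
    have hint : IntegrableOn (fun s => p s - p t) (Metric.closedBall t r) :=
      hloc.integrableOn_isCompact (isCompact_closedBall _ _)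
    rw [← ofReal_integral_norm_eq_lintegral_enorm hint]
    exact ENNReal.ofReal_le_ofReal (by linarith)
  obtain ⟨r₀, hr₀, hsub⟩ := mem_nhdsGT_iff_exists_Ioc_subset.1 hball
  have hr₀ : 0 < r₀ := hr₀
  set B := Metric.closedBall t r₀
  have hBm : MeasurableSet B := Metric.isClosed_closedBall.measurableSet
  set A := ∫⁻ s, ENNReal.ofReal (((s - t) ^ 2 + 1)⁻¹) * ‖p s - p t‖ₑ
  have hA : A ≠ ∞ := (lintegral_inv_sq_add_one_mul_enorm_lt_top hp t (p t)).ne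
  have hsmall : ∀ᶠ y : ℝ in 𝓝[>] 0, ENNReal.ofReal (y * (1 + 1 / r₀ ^ 2)) * A ≤ ε / 2 := by
    have h0 : Tendsto (fun y : ℝ => ENNReal.ofReal (y * (1 + 1 / r₀ ^ 2)) * A) (𝓝[>] 0) (𝓝 0) := by
      have h1 : Tendsto (fun y : ℝ => ENNReal.ofReal (y * (1 + 1 / r₀ ^ 2))) (𝓝[>] 0) (𝓝 0) := by
        have : Continuous fun y : ℝ => ENNReal.ofReal (y * (1 + 1 / r₀ ^ 2)) :=
          ENNReal.continuous_ofReal.comp (by fun_prop)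
        have h2 := this.tendsto 0
        simp only [zero_mul, ENNReal.ofReal_zero] at h2
        exact h2.mono_left nhdsWithin_le_nhds
      have := ENNReal.Tendsto.mul_const h1 (Or.inr hA)
      simpa using this
    exact (ENNReal.tendsto_nhds_zero.1 h0) _ (ENNReal.half_pos hε.ne')
  filter_upwards [hsmall, self_mem_nhdsWithin] with y hy hy0
  have hy0 : 0 < y := hy0
  -- After cutting off outside `B` the smallness of the means persists at every radius, since beyond
  -- `r₀` the integral no longer grows. So the dyadic bound applies with `C = 2 * δ`, the 2 coming
  -- from the length of a ball.
  have hnear : ∫⁻ s, ENNReal.ofReal (y / ((s - t) ^ 2 + y ^ 2)) *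
      B.indicator (fun s => ‖p s - p t‖ₑ) s ≤ ENNReal.ofReal (8 * (2 * δ)) := by
    refine lintegral_div_sq_add_sq_mul_le (hmeas.indicator hBm) (by positivity) (fun r hr => ?_) hy0
    rw [setLIntegral_indicator hBm]
    rcases le_total r r₀ with hle | hle
    · exact (lintegral_mono_set Set.inter_subset_right).trans (hsub ⟨hr, hle⟩)
    · refine (lintegral_mono_set Set.inter_subset_left).trans ((hsub ⟨hr₀, le_rfl⟩).trans ?_)
      exact ENNReal.ofReal_le_ofReal (by nlinarith)
  -- At distance more than `r₀` from `t` the kernel is at most `y * (1 + 1 / r₀ ^ 2)` times the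
  -- kernel of height one, which tends to zero with `y`.
  have hfar : ∫⁻ s, ENNReal.ofReal (y / ((s - t) ^ 2 + y ^ 2)) *
      Bᶜ.indicator (fun s => ‖p s - p t‖ₑ) s ≤ ENNReal.ofReal (y * (1 + 1 / r₀ ^ 2)) * A := by
    rw [← lintegral_const_mul' _ _ ENNReal.ofReal_ne_top]
    refine lintegral_mono fun s => ?_
    by_cases hs : s ∈ B
    · simp [hs]
    · rw [Set.indicator_of_mem hs, ← mul_assoc, ← ENNReal.ofReal_mul (by positivity)]
      gcongr
      rw [Metric.mem_closedBall, Real.dist_eq, not_le] at hs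
      have h1 : r₀ ^ 2 < (s - t) ^ 2 := by
        rw [← sq_abs (s - t)]
        exact pow_lt_pow_left₀ hs hr₀.le two_ne_zero
      have h2 : (s - t) ^ 2 + 1 ≤ (1 + 1 / r₀ ^ 2) * ((s - t) ^ 2 + y ^ 2) := by
        have h3 : 1 ≤ 1 / r₀ ^ 2 * (s - t) ^ 2 := by
          rw [one_div, ← div_eq_inv_mul, one_le_div (by positivity)]
          exact h1.le
        have h4 : 0 ≤ (1 + 1 / r₀ ^ 2) * y ^ 2 := by positivity
        nlinarith
      rw [mul_assoc, ← div_eq_mul_inv, div_eq_mul_one_div]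
      refine mul_le_mul_of_nonneg_left ?_ hy0.le
      rw [div_le_div_iff₀ (by positivity) (by positivity)]
      linarith
  calc ∫⁻ s, ENNReal.ofReal (y / ((s - t) ^ 2 + y ^ 2)) * ‖p s - p t‖ₑ
      = (∫⁻ s, ENNReal.ofReal (y / ((s - t) ^ 2 + y ^ 2)) *
          B.indicator (fun s => ‖p s - p t‖ₑ) s) +
        ∫⁻ s, ENNReal.ofReal (y / ((s - t) ^ 2 + y ^ 2)) *
          Bᶜ.indicator (fun s => ‖p s - p t‖ₑ) s := by
        rw [← lintegral_add_left']
        · congr 1 with s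
          rw [← mul_add, Set.indicator_self_add_compl_apply]
        · refine AEMeasurable.mul ?_ (hmeas.indicator hBm)
          exact (by fun_prop : Measurable fun s : ℝ =>
            ENNReal.ofReal (y / ((s - t) ^ 2 + y ^ 2))).aemeasurable
    _ ≤ ε / 2 + ε / 2 := add_le_add (hnear.trans hδε) (hfar.trans hy)
    _ = ε := ENNReal.add_halves ε

lemma poissonIntegrand_integrable {p : ℝ → ℂ} (hp : MemLp p 2) {ζ : ℂ} (hζ : 0 < ζ.im) :
    Integrable (fun t => (halfPlanePoisson ζ t : ℂ) * p t) := by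
  have hm : AEStronglyMeasurable (fun s : ℝ => ((halfPlanePoisson ζ s : ℝ) : ℂ)) :=
    (Complex.continuous_ofReal.comp (continuous_halfPlanePoisson hζ)).aestronglyMeasurable
  have hk : MemLp (fun s : ℝ => ((halfPlanePoisson ζ s : ℝ) : ℂ)) 2 := by
    rw [memLp_two_iff_integrable_sq_norm hm]
    refine ((integrable_halfPlanePoisson hζ).const_mul (Real.pi⁻¹ * ζ.im⁻¹)).mono'
      (hm.norm.pow 2) (Eventually.of_forall fun s => ?_)
    have h1 := halfPlanePoisson_nonneg hζ s
    have h2 : halfPlanePoisson ζ s ≤ Real.pi⁻¹ * ζ.im⁻¹ := by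
      unfold halfPlanePoisson
      gcongr
      rw [div_le_iff₀ (by positivity), inv_mul_eq_div, le_div_iff₀ hζ]
      nlinarith [sq_nonneg (s - ζ.re)]
    simp only [Complex.norm_real, Real.norm_eq_abs, abs_pow, abs_of_nonneg h1]
    nlinarith
  exact hk.integrable_mul hp

/-- Fatou's theorem: the Poisson integral of an `L²` function has nontangential boundary values
almost everywhere. -/
lemma ae_tendsto_poissonIntegral {p : ℝ → ℂ} (hp : MemLp p 2) :
    ∀ᵐ t : ℝ, ∀ k : ℝ, Tendsto (poissonIntegral p) (𝓝[cone 1 k t] (t : ℂ)) (𝓝 (p t)) := by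
  filter_upwards [IsUnifLocDoublingMeasure.ae_tendsto_average_norm_sub volume
    (hp.locallyIntegrable (by norm_num)) 1] with t ht k
  have hleb : Tendsto (fun r : ℝ => ⨍ s in Metric.closedBall t r, ‖p s - p t‖)
      (𝓝[>] 0) (𝓝 0) := by
    refine ht (fun _ => t) (fun r => r) tendsto_id ?_
    filter_upwards [self_mem_nhdsWithin] with r hr
    simpa using (Set.mem_Ioi.1 hr).le
  have hJ := tendsto_lintegral_poisson_of_lebesgue hp hleb
  have him : Tendsto Complex.im (𝓝[cone 1 k t] (t : ℂ)) (𝓝[>] 0) := by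
    refine tendsto_nhdsWithin_iff.2 ⟨?_, ?_⟩
    · have := (Complex.continuous_im.tendsto (t : ℂ)).mono_left
        (nhdsWithin_le_nhds (s := cone 1 k t))
      simpa using this
    · filter_upwards [self_mem_nhdsWithin] with ζ hζ
      have := hζ.1
      simpa using this
  -- Nontangential approach reduces to vertical approach: in the cone, the kernel centred at `ζ.re`
  -- is at most `2 * k ^ 2 + 2` times the one of the same height centred at `t`.
  have hlim := ENNReal.Tendsto.const_mul (a := ENNReal.ofReal (Real.pi⁻¹ * (2 * k ^ 2 + 2)))
    (hJ.comp him) (Or.inr ENNReal.ofReal_ne_top)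
  rw [mul_zero] at hlim
  rw [tendsto_iff_edist_tendsto_0]
  refine tendsto_of_tendsto_of_tendsto_of_le_of_le' tendsto_const_nhds hlim
    (Eventually.of_forall fun _ => zero_le) ?_
  filter_upwards [self_mem_nhdsWithin] with ζ hζ
  have hy : 0 < ζ.im := by simpa using hζ.1
  have hx : |ζ.re - t| ≤ k * ζ.im := by simpa using hζ.2
  have hrepr : poissonIntegral p ζ - p t =
      ∫ s, (halfPlanePoisson ζ s : ℂ) * (p s - p t) := by
    simp_rw [mul_sub]
    have hK : Integrable (fun s => (halfPlanePoisson ζ s : ℂ)) :=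
      (integrable_halfPlanePoisson hy).ofReal
    rw [integral_sub (poissonIntegrand_integrable hp hy) (hK.mul_const (p t)), integral_mul_const,
      integral_complex_ofReal, integral_halfPlanePoisson hy]
    simp [poissonIntegral]
  rw [edist_eq_enorm_sub, hrepr]
  refine (enorm_integral_le_lintegral_enorm _).trans ?_
  rw [Function.comp_apply, ← lintegral_const_mul' _ _ ENNReal.ofReal_ne_top]
  refine lintegral_mono fun s => ?_
  rw [enorm_mul, ← ofReal_norm (E := ℂ) (halfPlanePoisson ζ s : ℝ), Complex.norm_real,
    Real.norm_eq_abs, abs_of_nonneg (halfPlanePoisson_nonneg hy s), ← mul_assoc,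
    ← ENNReal.ofReal_mul (by positivity)]
  gcongr
  unfold halfPlanePoisson
  rw [mul_assoc]
  gcongr
  rw [← mul_div_assoc, div_le_div_iff₀ (by positivity) (by positivity)]
  have hsq : (ζ.re - t) ^ 2 ≤ (k * ζ.im) ^ 2 := by
    rw [← sq_abs (ζ.re - t)]
    exact pow_le_pow_left₀ (abs_nonneg _) hx 2
  have : (s - t) ^ 2 + ζ.im ^ 2 ≤ (2 * k ^ 2 + 2) * ((s - ζ.re) ^ 2 + ζ.im ^ 2) := by
    nlinarith [sq_nonneg ((s - ζ.re) - (ζ.re - t)), sq_nonneg (k * (s - ζ.re)), sq_nonneg ζ.im]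
  nlinarith

/-- Jensen's inequality for the probability density `K`, in the form of Cauchy–Schwarz with `K`
split as `K ^ (1/2) * K ^ (1/2)`. -/
lemma enorm_poissonIntegral_sq_le {p : ℝ → ℂ} (hp : AEStronglyMeasurable p) {ζ : ℂ}
    (hζ : 0 < ζ.im) :
    ‖poissonIntegral p ζ‖ₑ ^ (2 : ℝ) ≤
      ∫⁻ t, ENNReal.ofReal (halfPlanePoisson ζ t) * ‖p t‖ₑ ^ (2 : ℝ) := by
  set K : ℝ → ℝ≥0∞ := fun t => ENNReal.ofReal (halfPlanePoisson ζ t) with hK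
  have hKm : AEMeasurable K :=
    (ENNReal.measurable_ofReal.comp (continuous_halfPlanePoisson hζ).measurable).aemeasurable
  have h1 : ‖poissonIntegral p ζ‖ₑ ≤ ∫⁻ t, (fun t => K t ^ (1 / 2 : ℝ)) t *
      (fun t => K t ^ (1 / 2 : ℝ) * ‖p t‖ₑ) t := by
    refine (enorm_integral_le_lintegral_enorm _).trans (lintegral_mono fun t => ?_)
    simp only
    rw [enorm_mul, ← ofReal_norm (E := ℂ) (halfPlanePoisson ζ t : ℝ), Complex.norm_real,
      Real.norm_eq_abs, abs_of_nonneg (halfPlanePoisson_nonneg hζ t), ← mul_assoc,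
      ← ENNReal.rpow_add_of_nonneg _ _ (by norm_num) (by norm_num)]
    norm_num [hK]
  have h2 := ENNReal.lintegral_mul_le_Lp_mul_Lq volume (Real.HolderConjugate.two_two)
    (hKm.pow_const (1 / 2 : ℝ)) ((hKm.pow_const (1 / 2 : ℝ)).mul hp.enorm)
  have h3 : ∀ t, (K t ^ (1 / 2 : ℝ)) ^ (2 : ℝ) = K t := fun t => by
    rw [← ENNReal.rpow_mul]; norm_num
  calc ‖poissonIntegral p ζ‖ₑ ^ (2 : ℝ)
      ≤ ((∫⁻ t, (K t ^ (1 / 2 : ℝ)) ^ (2 : ℝ)) ^ (1 / 2 : ℝ) *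
          (∫⁻ t, (K t ^ (1 / 2 : ℝ) * ‖p t‖ₑ) ^ (2 : ℝ)) ^ (1 / 2 : ℝ)) ^ (2 : ℝ) :=
        ENNReal.rpow_le_rpow (h1.trans h2) (by norm_num)
    _ = ∫⁻ t, K t * ‖p t‖ₑ ^ (2 : ℝ) := by
        simp_rw [ENNReal.mul_rpow_of_nonneg _ _ (zero_le_two (α := ℝ)), h3]
        rw [hK, lintegral_halfPlanePoisson hζ, ENNReal.one_rpow, ENNReal.one_rpow, one_mul,
          ← ENNReal.rpow_mul]
        norm_num

/-- The Poisson semigroup is a contraction on `L²`. -/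
lemma eLpNorm_poissonIntegral_le {p : ℝ → ℂ} (hp : AEStronglyMeasurable p) {y : ℝ} (hy : 0 < y) :
    eLpNorm (fun t : ℝ => poissonIntegral p ((t : ℂ) + y * Complex.I)) 2 volume ≤
      eLpNorm p 2 volume := by
  rw [eLpNorm_eq_lintegral_rpow_enorm_toReal (by norm_num) (by norm_num),
    eLpNorm_eq_lintegral_rpow_enorm_toReal (by norm_num) (by norm_num)]
  simp only [ENNReal.toReal_ofNat]
  refine ENNReal.rpow_le_rpow ?_ (by norm_num)
  have him : ∀ t : ℝ, ((t : ℂ) + y * Complex.I).im = y := fun t => by simp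
  have hre : ∀ t : ℝ, ((t : ℂ) + y * Complex.I).re = t := fun t => by simp
  -- Symmetry gives the kernel total mass one in the other variable too, which is what remains after
  -- Tonelli.
  have hsymm : ∀ t s : ℝ, halfPlanePoisson ((t : ℂ) + y * Complex.I) s =
      halfPlanePoisson ((s : ℂ) + y * Complex.I) t := fun t s => by
    simp only [halfPlanePoisson, him, hre]
    rw [← neg_sub s t, neg_sq]
  calc ∫⁻ t : ℝ, ‖poissonIntegral p ((t : ℂ) + y * Complex.I)‖ₑ ^ (2 : ℝ)
      ≤ ∫⁻ t : ℝ, ∫⁻ s, ENNReal.ofReal (halfPlanePoisson ((t : ℂ) + y * Complex.I) s) *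
          ‖p s‖ₑ ^ (2 : ℝ) :=
        lintegral_mono fun t => enorm_poissonIntegral_sq_le hp (by rw [him]; exact hy)
    _ = ∫⁻ s : ℝ, ∫⁻ t : ℝ, ENNReal.ofReal (halfPlanePoisson ((t : ℂ) + y * Complex.I) s) *
          ‖p s‖ₑ ^ (2 : ℝ) := by
        refine lintegral_lintegral_swap (AEMeasurable.mul ?_ ?_)
        · refine Measurable.aemeasurable ?_
          simp only [halfPlanePoisson, him, hre]
          fun_prop
        · exact (hp.enorm.pow_const _).comp_snd
    _ = ∫⁻ s : ℝ, ‖p s‖ₑ ^ (2 : ℝ) := by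
        refine lintegral_congr fun s => ?_
        rw [lintegral_mul_const]
        · simp_rw [hsymm _ s]
          rw [lintegral_halfPlanePoisson (by rw [him]; exact hy), one_mul]
        · simp only [halfPlanePoisson, him, hre]
          fun_prop

/-! ### Weak convergence of bounded families in `L²`. -/

lemma integral_sq_norm_eq_toReal_eLpNorm {f : ℝ → ℂ} (hf : MemLp f 2) :
    ∫ t, ‖f t‖ ^ 2 = (eLpNorm f 2 volume).toReal ^ 2 := by
  rw [eLpNorm_eq_lintegral_rpow_enorm_toReal (by norm_num) (by norm_num),
    integral_eq_lintegral_of_nonneg_ae (f := fun t => ‖f t‖ ^ 2)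
      (Eventually.of_forall fun t => by positivity) (hf.1.norm.pow 2)]
  simp only [ENNReal.toReal_ofNat]
  rw [← ENNReal.toReal_pow, ← ENNReal.rpow_natCast, ← ENNReal.rpow_mul]
  norm_num

/-- A bounded family in `L²` that tends to zero almost everywhere tends to zero weakly. -/
lemma tendsto_integral_mul_zero {ι : Type*} {l : Filter ι} [l.IsCountablyGenerated]
    {f : ι → ℝ → ℂ} {C : ℝ} (hf : ∀ᶠ i in l, MemLp (f i) 2 ∧ ∫ t, ‖f i t‖ ^ 2 ≤ C)
    (hlim : ∀ᵐ t, Tendsto (fun i => f i t) l (𝓝 0)) {φ : ℝ → ℂ} (hφ : MemLp φ 2) :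
    Tendsto (fun i => ∫ t, f i t * φ t) l (𝓝 0) := by
  rcases l.eq_or_neBot with rfl | hne
  · exact tendsto_bot
  have hC : 0 ≤ C := by
    obtain ⟨i, hi⟩ := hf.exists
    exact (integral_nonneg fun t => by positivity).trans hi.2
  have hφ2 : Integrable (fun t => ‖φ t‖ ^ 2) := (memLp_two_iff_integrable_sq_norm hφ.1).1 hφ
  rw [Metric.tendsto_nhds]
  intro ε hε
  -- Where `‖f‖ ≤ M‖φ‖` the product is dominated by `M‖φ‖²` and dominated convergence applies.
  -- Elsewhere it is at most `‖f‖² / M`, and this `M` makes the integral of that at most `ε / 2`.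
  set M : ℝ := 2 * (C + 1) / ε
  have hM : 0 < M := by positivity
  have hdom : Tendsto (fun i => ∫ t, min (‖f i t‖ * ‖φ t‖) (M * ‖φ t‖ ^ 2)) l (𝓝 0) := by
    have := tendsto_integral_filter_of_dominated_convergence (μ := volume) (l := l)
      (F := fun i t => min (‖f i t‖ * ‖φ t‖) (M * ‖φ t‖ ^ 2)) (f := fun _ => 0)
      (fun t => M * ‖φ t‖ ^ 2) ?_ ?_ (hφ2.const_mul M) ?_
    · simpa using this
    · filter_upwards [hf] with i hi
      exact (hi.1.1.norm.mul hφ.1.norm).inf ((hφ.1.norm.pow 2).const_mul M)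
    · filter_upwards with i
      filter_upwards with t
      rw [Real.norm_of_nonneg (by positivity)]
      exact min_le_right _ _
    · filter_upwards [hlim] with t ht
      have h1 : Tendsto (fun i => ‖f i t‖ * ‖φ t‖) l (𝓝 0) := by
        simpa using ht.norm.mul_const ‖φ t‖
      refine tendsto_of_tendsto_of_tendsto_of_le_of_le tendsto_const_nhds h1 (fun i => ?_)
        (fun i => min_le_left _ _)
      positivity
  filter_upwards [hf, hdom.eventually (gt_mem_nhds (half_pos hε))] with i hi hsm
  have hf2 : Integrable (fun t => ‖f i t‖ ^ 2) := (memLp_two_iff_integrable_sq_norm hi.1.1).1 hi.1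
  have hfφ : Integrable (fun t => ‖f i t‖ * ‖φ t‖) := hi.1.norm.integrable_mul hφ.norm
  have hmin : Integrable (fun t => min (‖f i t‖ * ‖φ t‖) (M * ‖φ t‖ ^ 2)) :=
    hfφ.inf (hφ2.const_mul M)
  rw [dist_zero_right]
  calc ‖∫ t, f i t * φ t‖ ≤ ∫ t, ‖f i t‖ * ‖φ t‖ := by
        refine (norm_integral_le_integral_norm _).trans_eq ?_
        simp_rw [norm_mul]
    _ ≤ ∫ t, (min (‖f i t‖ * ‖φ t‖) (M * ‖φ t‖ ^ 2) + M⁻¹ * ‖f i t‖ ^ 2) := by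
        refine integral_mono hfφ (hmin.add (hf2.const_mul _)) fun t => ?_
        simp only
        rcases le_total (‖f i t‖) (M * ‖φ t‖) with h | h
        · rw [min_eq_left (by nlinarith [norm_nonneg (φ t)])]
          have : 0 ≤ M⁻¹ * ‖f i t‖ ^ 2 := by positivity
          linarith
        · have h1 : ‖φ t‖ ≤ M⁻¹ * ‖f i t‖ := by rwa [inv_mul_eq_div, le_div_iff₀' hM]
          have h2 : 0 ≤ min (‖f i t‖ * ‖φ t‖) (M * ‖φ t‖ ^ 2) := by positivity
          nlinarith [norm_nonneg (f i t)]
    _ = (∫ t, min (‖f i t‖ * ‖φ t‖) (M * ‖φ t‖ ^ 2)) + M⁻¹ * ∫ t, ‖f i t‖ ^ 2 := by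
        rw [integral_add hmin (hf2.const_mul _), integral_const_mul]
    _ < ε / 2 + ε / 2 := by
        refine add_lt_add_of_lt_of_le hsm ?_
        calc M⁻¹ * ∫ t, ‖f i t‖ ^ 2 ≤ M⁻¹ * (C + 1) := by
              gcongr
              linarith [hi.2]
          _ = ε / 2 := by
              simp only [M]
              field_simp
    _ = ε := add_halves ε

/-- A bounded family in `L²` that converges almost everywhere converges weakly. -/
lemma tendsto_integral_mul_of_bounded {ι : Type*} {l : Filter ι} [l.IsCountablyGenerated]
    {f : ι → ℝ → ℂ} {C : ℝ≥0} {g : ℝ → ℂ}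
    (hf : ∀ᶠ i in l, MemLp (f i) 2 ∧ eLpNorm (f i) 2 volume ≤ C) (hg : MemLp g 2)
    (hlim : ∀ᵐ t, Tendsto (fun i => f i t) l (𝓝 (g t))) {φ : ℝ → ℂ} (hφ : MemLp φ 2) :
    Tendsto (fun i => ∫ t, f i t * φ t) l (𝓝 (∫ t, g t * φ t)) := by
  have h0 := tendsto_integral_mul_zero (f := fun i t => f i t - g t) (l := l) (φ := φ)
    (C := (C + (eLpNorm g 2 volume).toReal) ^ 2) ?_ ?_ hφ
  · have h1 := h0.add_const (∫ t, g t * φ t)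
    rw [zero_add] at h1
    refine h1.congr' ?_
    filter_upwards [hf] with i hi
    simp_rw [sub_mul]
    have h2 : Integrable (fun t => f i t * φ t) := hi.1.integrable_mul hφ
    have h3 : Integrable (fun t => g t * φ t) := hg.integrable_mul hφ
    rw [integral_sub h2 h3, sub_add_cancel]
  · filter_upwards [hf] with i hi
    refine ⟨hi.1.sub hg, ?_⟩
    refine (integral_sq_norm_eq_toReal_eLpNorm (hi.1.sub hg)).trans_le ?_
    gcongr
    have h2 : eLpNorm (f i - g) 2 volume ≤ C + eLpNorm g 2 volume :=
      (eLpNorm_sub_le hi.1.1 hg.1 (by norm_num)).trans (by gcongr; exact hi.2)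
    refine (ENNReal.toReal_mono (by finiteness [hg.2.ne]) h2).trans_eq ?_
    rw [ENNReal.toReal_add (by simp) hg.2.ne, ENNReal.coe_toReal]
  · filter_upwards [hlim] with t ht
    simpa using ht.sub_const (g t)

/-! ### The Cauchy kernel and the Cauchy integral off the real line. -/

/-- The Cauchy kernel. -/
def cauchyKernel (ζ : ℂ) (t : ℝ) : ℂ := ((t : ℂ) - ζ)⁻¹

lemma ofReal_sub_ne_zero {ζ : ℂ} (hζ : ζ.im ≠ 0) (t : ℝ) : (t : ℂ) - ζ ≠ 0 := fun h => hζ (by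
  have := congrArg Complex.im h
  simpa using this)

lemma continuous_cauchyKernel {ζ : ℂ} (hζ : ζ.im ≠ 0) : Continuous (cauchyKernel ζ) := by
  unfold cauchyKernel
  exact Continuous.inv₀ (by fun_prop) (ofReal_sub_ne_zero hζ)

lemma sq_norm_cauchyKernel (ζ : ℂ) (t : ℝ) :
    ‖cauchyKernel ζ t‖ ^ 2 = ((t - ζ.re) ^ 2 + ζ.im ^ 2)⁻¹ := by
  rw [cauchyKernel, norm_inv, inv_pow, Complex.sq_norm, Complex.normSq_apply]
  simp only [Complex.sub_re, Complex.ofReal_re, Complex.sub_im, Complex.ofReal_im]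
  congr 1
  ring

lemma memLp_cauchyKernel {ζ : ℂ} (hζ : ζ.im ≠ 0) : MemLp (cauchyKernel ζ) 2 := by
  rw [memLp_two_iff_integrable_sq_norm (continuous_cauchyKernel hζ).aestronglyMeasurable]
  simp_rw [sq_norm_cauchyKernel]
  refine ((integrable_div_sq_add_sq ζ.re hζ).const_mul ζ.im⁻¹).congr
    (Eventually.of_forall fun t => ?_)
  simp only
  field_simp

lemma integral_sq_norm_cauchyKernel_le {ζ : ℂ} {δ : ℝ} (hδ : 0 < δ) (hζ : δ ≤ |ζ.im|) :
    ∫ t, ‖cauchyKernel ζ t‖ ^ 2 ≤ Real.pi / δ := by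
  have h : ∀ t, ‖cauchyKernel ζ t‖ ^ 2 =
      |ζ.im|⁻¹ * (|ζ.im| / ((t - ζ.re) ^ 2 + |ζ.im| ^ 2)) := fun t => by
    have : |ζ.im| ≠ 0 := (hδ.trans_le hζ).ne'
    rw [sq_norm_cauchyKernel, sq_abs]
    field_simp
  simp_rw [h]
  rw [integral_const_mul, integral_div_sq_add_sq _ (hδ.trans_le hζ), inv_mul_eq_div]
  gcongr

lemma norm_cauchyKernel_le {ζ : ℂ} (hζ : ζ.im ≠ 0) (t : ℝ) : ‖cauchyKernel ζ t‖ ≤ |ζ.im|⁻¹ := by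
  rw [cauchyKernel, norm_inv]
  have h := Complex.abs_im_le_norm ((t : ℂ) - ζ)
  simp only [Complex.sub_im, Complex.ofReal_im, zero_sub, abs_neg] at h
  exact inv_anti₀ (abs_pos.2 hζ) h

lemma conj_cauchyKernel (ζ : ℂ) (t : ℝ) : conj (cauchyKernel ζ t) = cauchyKernel (conj ζ) t := by
  simp [cauchyKernel]

lemma cauchy_eq (h : ℝ → ℂ) (ζ : ℂ) :
    cauchy h ζ = (2 * Real.pi * Complex.I)⁻¹ * ∫ t, cauchyKernel ζ t * h t := by
  simp only [cauchy, cauchyKernel, div_eq_inv_mul]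

lemma cauchy_congr_ae {h k : ℝ → ℂ} (hk : h =ᵐ[volume] k) : cauchy h = cauchy k := by
  ext ζ
  rw [cauchy_eq, cauchy_eq]
  congr 1
  refine integral_congr_ae ?_
  filter_upwards [hk] with t ht
  rw [ht]

lemma integrable_cauchyKernel_mul {h : ℝ → ℂ} (hh : MemLp h 2) {ζ : ℂ} (hζ : ζ.im ≠ 0) :
    Integrable (fun t => cauchyKernel ζ t * h t) :=
  (memLp_cauchyKernel hζ).integrable_mul hh

lemma cauchy_add {h k : ℝ → ℂ} (hh : MemLp h 2) (hk : MemLp k 2) {ζ : ℂ} (hζ : ζ.im ≠ 0) :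
    cauchy (fun t => h t + k t) ζ = cauchy h ζ + cauchy k ζ := by
  simp only [cauchy_eq, mul_add]
  rw [integral_add (integrable_cauchyKernel_mul hh hζ) (integrable_cauchyKernel_mul hk hζ), mul_add]

lemma cauchy_sub {h k : ℝ → ℂ} (hh : MemLp h 2) (hk : MemLp k 2) {ζ : ℂ} (hζ : ζ.im ≠ 0) :
    cauchy (fun t => h t - k t) ζ = cauchy h ζ - cauchy k ζ := by
  simp only [cauchy_eq, mul_sub]
  rw [integral_sub (integrable_cauchyKernel_mul hh hζ) (integrable_cauchyKernel_mul hk hζ), mul_sub]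

lemma cauchyKernel_sub_conj {ζ : ℂ} (hζ : 0 < ζ.im) (t : ℝ) :
    (2 * Real.pi * Complex.I)⁻¹ * (cauchyKernel ζ t - cauchyKernel (conj ζ) t) =
      halfPlanePoisson ζ t := by
  have hζ' : (conj ζ).im ≠ 0 := by simpa using hζ.ne'
  have h1 := ofReal_sub_ne_zero hζ.ne' t
  have h2 := ofReal_sub_ne_zero hζ' t
  have h3 : ((t : ℂ) - ζ) * ((t : ℂ) - conj ζ) = (((t - ζ.re) ^ 2 + ζ.im ^ 2 : ℝ) : ℂ) := by
    apply Complex.ext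
    · simp [pow_two]
    · simp [pow_two]
      ring
  have h4 : (t : ℂ) - conj ζ - (t - ζ) = 2 * Complex.I * (ζ.im : ℂ) := by
    rw [sub_sub_sub_cancel_left, Complex.sub_conj]
    push_cast
    ring
  rw [cauchyKernel, cauchyKernel, inv_sub_inv h1 h2, halfPlanePoisson, h3, h4]
  push_cast
  have h6 : ((t : ℂ) - ζ.re) ^ 2 + (ζ.im : ℂ) ^ 2 ≠ 0 := by
    have : (((t - ζ.re) ^ 2 + ζ.im ^ 2 : ℝ) : ℂ) ≠ 0 := by
      rw [Complex.ofReal_ne_zero]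
      positivity
    push_cast at this
    exact this
  have h7 : (Real.pi : ℂ) ≠ 0 := by exact_mod_cast Real.pi_ne_zero
  have h8 := Complex.I_ne_zero
  field_simp

/-- The jump of the Cauchy integral across the real line is the Poisson integral. -/
lemma cauchy_sub_cauchy_conj {h : ℝ → ℂ} (hh : MemLp h 2) {ζ : ℂ} (hζ : 0 < ζ.im) :
    cauchy h ζ - cauchy h (conj ζ) = poissonIntegral h ζ := by
  have hζ' : (conj ζ).im ≠ 0 := by simpa using hζ.ne'
  rw [cauchy_eq, cauchy_eq, ← mul_sub, ← integral_sub (integrable_cauchyKernel_mul hh hζ.ne')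
    (integrable_cauchyKernel_mul hh hζ'), ← integral_const_mul, poissonIntegral]
  congr 1 with t
  rw [← sub_mul, ← mul_assoc, cauchyKernel_sub_conj hζ]

lemma differentiableAt_cauchy {h : ℝ → ℂ} (hh : MemLp h 2) {ζ : ℂ} (hζ : ζ.im ≠ 0) :
    DifferentiableAt ℂ (cauchy h) ζ := by
  -- On this ball the distance to a real point is at least half that from `ζ`, so the squared kernel
  -- loses only a factor 4, uniformly in `w`.
  have hr : 0 < |ζ.im| / 2 := by positivity
  have him : ∀ w ∈ Metric.ball ζ (|ζ.im| / 2), w.im ≠ 0 := fun w hw h0 => by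
    have h1 := Complex.abs_im_le_norm (w - ζ)
    rw [Metric.mem_ball, dist_eq_norm] at hw
    rw [Complex.sub_im, h0, zero_sub, abs_neg] at h1
    linarith [abs_pos.2 hζ]
  have hkey : HasDerivAt (fun w => ∫ t, cauchyKernel w t * h t)
      (∫ t, cauchyKernel ζ t ^ 2 * h t) ζ := by
    refine (hasDerivAt_integral_of_dominated_loc_of_deriv_le (Metric.ball_mem_nhds ζ hr)
      (F := fun w t => cauchyKernel w t * h t) (F' := fun w t => cauchyKernel w t ^ 2 * h t)
      (bound := fun t => 4 * |ζ.im|⁻¹ * ‖cauchyKernel ζ t * h t‖) ?_ ?_ ?_ ?_ ?_ ?_).2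
    · filter_upwards [Metric.ball_mem_nhds ζ hr] with w hw
      exact (integrable_cauchyKernel_mul hh (him w hw)).1
    · exact integrable_cauchyKernel_mul hh hζ
    · exact ((continuous_cauchyKernel hζ).pow 2).aestronglyMeasurable.mul hh.1
    · filter_upwards with t w hw
      have h1 : |ζ.im| ≤ ‖(t : ℂ) - ζ‖ := by
        simpa using Complex.abs_im_le_norm ((t : ℂ) - ζ)
      have h2 : ‖(t : ℂ) - ζ‖ ≤ 2 * ‖(t : ℂ) - w‖ := by
        rw [Metric.mem_ball, dist_eq_norm] at hw
        have := norm_add_le ((t : ℂ) - w) (w - ζ)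
        rw [sub_add_sub_cancel] at this
        linarith
      have h3 : 0 < ‖(t : ℂ) - ζ‖ := (abs_pos.2 hζ).trans_le h1
      have h4 : ‖cauchyKernel w t‖ ≤ 2 * ‖cauchyKernel ζ t‖ := by
        rw [cauchyKernel, cauchyKernel, norm_inv, norm_inv, ← div_eq_mul_inv, le_div_iff₀ h3,
          inv_mul_le_iff₀ (by linarith)]
        linarith
      calc ‖cauchyKernel w t ^ 2 * h t‖ = ‖cauchyKernel w t‖ ^ 2 * ‖h t‖ := by
            rw [norm_mul, norm_pow]
        _ ≤ (2 * ‖cauchyKernel ζ t‖) ^ 2 * ‖h t‖ := by gcongr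
        _ = 4 * ‖cauchyKernel ζ t‖ * (‖cauchyKernel ζ t‖ * ‖h t‖) := by ring
        _ ≤ 4 * |ζ.im|⁻¹ * (‖cauchyKernel ζ t‖ * ‖h t‖) := by
            gcongr
            exact norm_cauchyKernel_le hζ t
        _ = _ := by rw [norm_mul]
    · exact (integrable_cauchyKernel_mul hh hζ).norm.const_mul _
    · filter_upwards with t w hw
      have h1 := ((hasDerivAt_id w).const_sub (t : ℂ)).inv (ofReal_sub_ne_zero (him w hw) t)
      have h2 := h1.mul_const (h t)
      refine h2.congr_deriv ?_
      simp [cauchyKernel, inv_pow]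
  have : cauchy h = fun w => (2 * Real.pi * Complex.I)⁻¹ * ∫ t, cauchyKernel w t * h t :=
    funext (cauchy_eq h)
  rw [this]
  exact (hkey.const_mul _).differentiableAt

/-- For `|Im ζ| ≥ δ` the kernels are bounded in `L²` and tend to zero pointwise as `ζ → ∞`, hence
weakly; no decay of `h` beyond `L²` is needed. -/
lemma tendsto_cauchy_cobounded {h : ℝ → ℂ} (hh : MemLp h 2) {s : Set ℂ} {δ : ℝ} (hδ : 0 < δ)
    (hs : ∀ ζ ∈ s, δ ≤ |ζ.im|) :
    Tendsto (cauchy h) (Bornology.cobounded ℂ ⊓ 𝓟 s) (𝓝 0) := by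
  have hcob : (Bornology.cobounded ℂ).IsCountablyGenerated := by
    rw [← comap_norm_atTop]
    infer_instance
  have h1 : Tendsto (fun ζ => ∫ t, cauchyKernel ζ t * h t) (Bornology.cobounded ℂ ⊓ 𝓟 s)
      (𝓝 0) := by
    refine tendsto_integral_mul_zero (C := Real.pi / δ) ?_ ?_ hh
    · filter_upwards [mem_inf_of_right (mem_principal_self s)] with ζ hζ
      refine ⟨memLp_cauchyKernel fun h0 => ?_, integral_sq_norm_cauchyKernel_le hδ (hs ζ hζ)⟩
      have := hs ζ hζ
      rw [h0, abs_zero] at this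
      linarith
    · filter_upwards with t
      refine Tendsto.mono_left ?_ inf_le_left
      have h2 : Tendsto (fun ζ : ℂ => (t : ℂ) - ζ) (Bornology.cobounded ℂ) (Bornology.cobounded ℂ) :=
        tendsto_const_sub_cobounded _
      exact tendsto_inv₀_cobounded.comp h2
  have h2 := h1.const_mul (2 * Real.pi * Complex.I)⁻¹
  rw [mul_zero] at h2
  exact h2.congr fun ζ => (cauchy_eq h ζ).symm

lemma tendsto_ofReal_sub_cobounded (a : ℂ) :
    Tendsto (fun t : ℝ => (t : ℂ) - a) (Bornology.cobounded ℝ) (Bornology.cobounded ℂ) := by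
  have h1 : Tendsto (fun t : ℝ => (t : ℂ)) (Bornology.cobounded ℝ) (Bornology.cobounded ℂ) :=
    Complex.isometry_ofReal.antilipschitz.tendsto_cobounded
  exact (tendsto_sub_const_cobounded a).comp h1

lemma tendsto_cauchyKernel_cobounded (a : ℂ) :
    Tendsto (cauchyKernel a) (Bornology.cobounded ℝ) (𝓝 0) :=
  tendsto_inv₀_cobounded.comp (tendsto_ofReal_sub_cobounded a)

lemma hasDerivAt_ofReal_sub (a : ℂ) (t : ℝ) : HasDerivAt (fun s : ℝ => (s : ℂ) - a) 1 t := by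
  simpa using (HasDerivAt.ofReal_comp (hasDerivAt_id t)).sub_const a

/-- The Cauchy kernels with poles in the lower half plane are orthogonal to those with poles in the
upper half plane. -/
lemma integral_cauchyKernel_mul_cauchyKernel {a b : ℂ} (ha : a.im < 0) (hb : b.im < 0) :
    ∫ t, cauchyKernel a t * cauchyKernel b t = 0 := by
  have hint : Integrable (fun t => cauchyKernel a t * cauchyKernel b t) :=
    integrable_cauchyKernel_mul (memLp_cauchyKernel hb.ne) ha.ne
  have hna := ofReal_sub_ne_zero ha.ne
  have hnb := ofReal_sub_ne_zero hb.ne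
  rcases eq_or_ne a b with rfl | hab
  · have hderiv : ∀ t : ℝ, HasDerivAt (fun t : ℝ => -cauchyKernel a t)
        (cauchyKernel a t * cauchyKernel a t) t := fun t => by
      have h := ((hasDerivAt_ofReal_sub a t).fun_inv (hna t)).neg
      refine h.congr_deriv ?_
      simp only [cauchyKernel]
      field_simp
    have hlim : Tendsto (fun t : ℝ => -cauchyKernel a t) (Bornology.cobounded ℝ) (𝓝 0) := by
      simpa using (tendsto_cauchyKernel_cobounded a).neg
    rw [IsOrderBornology.cobounded_eq] at hlim
    rw [integral_of_hasDerivAt_of_tendsto hderiv hint (hlim.mono_left le_sup_left)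
      (hlim.mono_left le_sup_right), sub_zero]
  -- The quotient never meets the cut of the logarithm: being real and nonpositive would force `Im
  -- (t - a)` and `Im (t - b)`, both positive, to have a nonpositive ratio. So the principal
  -- logarithm gives a global antiderivative, and it vanishes at both ends because the quotient
  -- tends to 1.
  · have hslit : ∀ t : ℝ, ((t : ℂ) - a) / ((t : ℂ) - b) ∈ Complex.slitPlane := fun t => by
      by_contra hcon
      rw [Complex.mem_slitPlane_iff, not_or, not_lt, not_not] at hcon
      set w := ((t : ℂ) - a) / ((t : ℂ) - b) with hw
      have h1 : (t : ℂ) - a = w * ((t : ℂ) - b) := by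
        rw [hw, div_mul_cancel₀ _ (hnb t)]
      have h2 := congrArg Complex.im h1
      rw [Complex.mul_im, hcon.2, zero_mul, add_zero] at h2
      simp only [Complex.sub_im, Complex.ofReal_im, zero_sub] at h2
      nlinarith [hcon.1]
    have hderiv : ∀ t : ℝ, HasDerivAt
        (fun t : ℝ => (a - b)⁻¹ * Complex.log (((t : ℂ) - a) / ((t : ℂ) - b)))
        (cauchyKernel a t * cauchyKernel b t) t := fun t => by
      have h1 := (hasDerivAt_ofReal_sub a t).fun_div (hasDerivAt_ofReal_sub b t) (hnb t)
      have h2 := (h1.clog_real (hslit t)).const_mul (a - b)⁻¹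
      refine h2.congr_deriv ?_
      have h3 := sub_ne_zero.2 hab
      have h4 := hna t
      have h5 := hnb t
      simp only [cauchyKernel]
      field_simp
      ring
    have hlim : Tendsto (fun t : ℝ => (a - b)⁻¹ * Complex.log (((t : ℂ) - a) / ((t : ℂ) - b)))
        (Bornology.cobounded ℝ) (𝓝 0) := by
      have h1 : Tendsto (fun t : ℝ => ((t : ℂ) - a) / ((t : ℂ) - b)) (Bornology.cobounded ℝ)
          (𝓝 1) := by
        have h2 := ((tendsto_cauchyKernel_cobounded b).const_mul (b - a)).const_add 1
        rw [mul_zero, add_zero] at h2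
        refine h2.congr fun t => ?_
        have h5 := hnb t
        simp only [cauchyKernel]
        field_simp
        ring
      have h3 := ((continuousAt_clog Complex.one_mem_slitPlane).tendsto.comp h1).const_mul
        (a - b)⁻¹
      rw [Complex.log_one, mul_zero] at h3
      exact h3
    rw [IsOrderBornology.cobounded_eq] at hlim
    rw [integral_of_hasDerivAt_of_tendsto hderiv hint (hlim.mono_left le_sup_left)
      (hlim.mono_left le_sup_right), sub_zero]

/-! ### The Hardy space and the Plemelj projection. -/

/-- The space `L²(ℝ)`. -/
abbrev L2 : Type := Lp ℂ 2 (volume : Measure ℝ)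

/-- The Cauchy kernel as an element of `L²`. -/
def cauchyKernelLp (ζ : ℂ) (hζ : ζ.im ≠ 0) : L2 := (memLp_cauchyKernel hζ).toLp _

/-- Turns vanishing of a Cauchy integral into orthogonality. The pole is conjugated because the
inner product conjugates its first argument. -/
lemma cauchy_eq_inner (h : L2) {ζ : ℂ} (hζ : (conj ζ).im ≠ 0) :
    cauchy h ζ = (2 * Real.pi * Complex.I)⁻¹ * inner ℂ (cauchyKernelLp (conj ζ) hζ) h := by
  rw [cauchy_eq, L2.inner_def]
  congr 1
  refine integral_congr_ae ?_
  filter_upwards [(memLp_cauchyKernel hζ).coeFn_toLp] with t ht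
  rw [cauchyKernelLp, ht, RCLike.inner_apply', conj_cauchyKernel, Complex.conj_conj]

/-- The Hardy space of the upper half plane, spanned by the Cauchy kernels with poles in the lower
half plane. -/
def hardyPlus : Submodule ℂ L2 :=
  (Submodule.span ℂ {u | ∃ (ζ : ℂ) (hζ : ζ.im < 0),
    u = cauchyKernelLp ζ hζ.ne}).topologicalClosure

instance : CompleteSpace hardyPlus :=
  (Submodule.isClosed_topologicalClosure _).completeSpace_coe

lemma cauchyKernelLp_mem_hardyPlus {ζ : ℂ} (hζ : ζ.im < 0) :
    cauchyKernelLp ζ hζ.ne ∈ hardyPlus :=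
  Submodule.le_topologicalClosure _ (Submodule.subset_span ⟨ζ, hζ, rfl⟩)

/-- The kernel with pole `conj ζ` above the axis is orthogonal to every generator of `hardyPlus`,
and orthogonality passes to the closed span. -/
lemma cauchy_eq_zero_of_mem_hardyPlus {p : L2} (hp : p ∈ hardyPlus) {ζ : ℂ} (hζ : ζ.im < 0) :
    cauchy p ζ = 0 := by
  have hζ' : (conj ζ).im ≠ 0 := by simpa using hζ.ne
  rw [cauchy_eq_inner p hζ']
  have hle : hardyPlus ≤ (ℂ ∙ cauchyKernelLp (conj ζ) hζ')ᗮ := by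
    refine Submodule.topologicalClosure_minimal _ ?_ (Submodule.isClosed_orthogonal _)
    rw [Submodule.span_le]
    rintro _ ⟨w, hw, rfl⟩
    rw [SetLike.mem_coe, Submodule.mem_orthogonal_singleton_iff_inner_right, L2.inner_def]
    rw [← integral_cauchyKernel_mul_cauchyKernel hζ hw]
    refine integral_congr_ae ?_
    filter_upwards [(memLp_cauchyKernel hζ').coeFn_toLp, (memLp_cauchyKernel hw.ne).coeFn_toLp]
      with t ht ht'
    rw [cauchyKernelLp, cauchyKernelLp, ht, ht', RCLike.inner_apply', conj_cauchyKernel,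
      Complex.conj_conj]
  rw [Submodule.mem_orthogonal_singleton_iff_inner_right.1 (hle hp), mul_zero]

lemma cauchy_eq_zero_of_mem_hardyPlus_orthogonal {q : L2} (hq : q ∈ hardyPlusᗮ) {ζ : ℂ}
    (hζ : 0 < ζ.im) : cauchy q ζ = 0 := by
  have hζ' : (conj ζ).im < 0 := by simpa using hζ
  rw [cauchy_eq_inner q hζ'.ne, Submodule.inner_right_of_mem_orthogonal
    (cauchyKernelLp_mem_hardyPlus hζ') hq, mul_zero]

/-- The orthogonal projection onto the Hardy space of the lower half plane; this is `-𝒫⁻`. -/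
def projLower : L2 →L[ℂ] L2 := hardyPlusᗮ.starProjection

lemma projLower_mem (h : L2) : projLower h ∈ hardyPlusᗮ := by
  rw [projLower]
  exact Submodule.starProjection_apply_mem _ _

lemma sub_projLower_mem (h : L2) : h - projLower h ∈ hardyPlus := by
  have := Submodule.sub_starProjection_mem_orthogonal (K := hardyPlusᗮ) h
  rwa [Submodule.orthogonal_orthogonal] at this

lemma projLower_projLower (h : L2) : projLower (projLower h) = projLower h := by
  rw [projLower]
  exact Submodule.starProjection_eq_self_iff.2 (Submodule.starProjection_apply_mem _ _)

lemma inner_projLower (u v : L2) : inner ℂ (projLower u) v = inner ℂ u (projLower v) :=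
  Submodule.inner_starProjection_left_eq_right _ u v

lemma cauchy_sub_Lp (u v : L2) {ζ : ℂ} (hζ : ζ.im ≠ 0) :
    cauchy ⇑(u - v) ζ = cauchy u ζ - cauchy v ζ := by
  rw [cauchy_congr_ae (Lp.coeFn_sub u v)]
  exact cauchy_sub (Lp.memLp u) (Lp.memLp v) hζ

/-- Split `h` into its `hardyPlus` part and `projLower h`. Above the axis the second has zero Cauchy
integral; the Cauchy integral of the first vanishes below, so above it equals its own jump, a
Poisson integral. -/
lemma cauchy_eq_poissonIntegral_of_im_pos (h : L2) {ζ : ℂ} (hζ : 0 < ζ.im) :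
    cauchy h ζ = poissonIntegral ⇑(h - projLower h) ζ := by
  have hζ' : (conj ζ).im < 0 := by simpa using hζ
  rw [← cauchy_sub_cauchy_conj (Lp.memLp _) hζ,
    cauchy_eq_zero_of_mem_hardyPlus (sub_projLower_mem h) hζ', sub_zero, cauchy_sub_Lp _ _ hζ.ne',
    cauchy_eq_zero_of_mem_hardyPlus_orthogonal (projLower_mem h) hζ, sub_zero]

lemma cauchy_eq_neg_poissonIntegral_of_im_neg (h : L2) {ζ : ℂ} (hζ : ζ.im < 0) :
    cauchy h ζ = -poissonIntegral ⇑(projLower h) (conj ζ) := by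
  have hζ' : 0 < (conj ζ).im := by simpa using hζ
  rw [← cauchy_sub_cauchy_conj (Lp.memLp _) hζ',
    cauchy_eq_zero_of_mem_hardyPlus_orthogonal (projLower_mem h) hζ', Complex.conj_conj, zero_sub,
    neg_neg, ← sub_eq_zero, ← cauchy_sub_Lp _ _ hζ.ne,
    cauchy_eq_zero_of_mem_hardyPlus (sub_projLower_mem h) hζ]

/-- The Cauchy integral of an `L²` function is of Hardy class in the upper half plane. -/
lemma isHardy_one_cauchy (h : L2) : IsHardy 1 (cauchy h) ⇑(h - projLower h) where
  analytic := fun ζ hζ => by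
    have hζ' : 0 < ζ.im := by simpa [halfPlane] using hζ
    exact (differentiableAt_cauchy (Lp.memLp h) hζ'.ne').differentiableWithinAt
  bounded := by
    refine ⟨‖h - projLower h‖₊, fun y hy => ?_⟩
    refine le_trans (le_of_eq ?_) ((eLpNorm_poissonIntegral_le
      (Lp.aestronglyMeasurable (h - projLower h)) hy).trans_eq ?_)
    · congr 1 with t
      rw [← cauchy_eq_poissonIntegral_of_im_pos h (by simpa using hy)]
      simp
    · rw [← enorm_eq_nnnorm, Lp.enorm_def]
  decay := fun δ hδ => tendsto_cauchy_cobounded (Lp.memLp h) hδ fun ζ hζ => by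
    have : δ ≤ ζ.im := by simpa using hζ
    exact this.trans (le_abs_self _)
  boundary_memLp := Lp.memLp _
  boundary := by
    filter_upwards [ae_tendsto_poissonIntegral (Lp.memLp (h - projLower h))] with t ht k
    refine (ht k).congr' ?_
    filter_upwards [self_mem_nhdsWithin] with ζ hζ
    exact (cauchy_eq_poissonIntegral_of_im_pos h (by simpa using hζ.1)).symm

/-- The Cauchy integral of an `L²` function is of Hardy class in the lower half plane. -/
lemma isHardy_neg_one_cauchy (h : L2) : IsHardy (-1) (cauchy h) ⇑(-projLower h) where
  analytic := fun ζ hζ => by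
    have hζ' : ζ.im < 0 := by simpa [halfPlane] using hζ
    exact (differentiableAt_cauchy (Lp.memLp h) hζ'.ne).differentiableWithinAt
  bounded := by
    refine ⟨‖projLower h‖₊, fun y hy => ?_⟩
    refine le_trans (le_of_eq ?_) ((eLpNorm_poissonIntegral_le
      (Lp.aestronglyMeasurable (projLower h)) hy).trans_eq ?_)
    · rw [← eLpNorm_neg]
      congr 1 with t
      rw [Pi.neg_apply, cauchy_eq_neg_poissonIntegral_of_im_neg h (by simpa using hy), neg_neg]
      simp
    · rw [← enorm_eq_nnnorm, Lp.enorm_def]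
  decay := fun δ hδ => tendsto_cauchy_cobounded (Lp.memLp h) hδ fun ζ hζ => by
    have : δ ≤ -ζ.im := by simpa using hζ
    exact this.trans (neg_le_abs _)
  boundary_memLp := Lp.memLp _
  boundary := by
    filter_upwards [ae_tendsto_poissonIntegral (Lp.memLp (projLower h)), Lp.coeFn_neg (projLower h)]
      with t ht hneg k
    have hconj : Tendsto (fun ζ : ℂ => conj ζ) (𝓝[cone (-1) k t] (t : ℂ)) (𝓝[cone 1 k t] (t : ℂ)) := by
      refine tendsto_nhdsWithin_iff.2 ⟨?_, ?_⟩
      · have := (Complex.continuous_conj.tendsto (t : ℂ)).mono_left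
          (nhdsWithin_le_nhds (s := cone (-1) k t))
        simpa using this
      · filter_upwards [self_mem_nhdsWithin] with ζ hζ
        simpa [cone] using hζ
    rw [hneg]
    refine ((ht k).comp hconj).neg.congr' ?_
    filter_upwards [self_mem_nhdsWithin] with ζ hζ
    exact (cauchy_eq_neg_poissonIntegral_of_im_neg h (by simpa using hζ.1)).symm

lemma IsHardy.tendsto_lower {f : ℂ → ℂ} {g : ℝ → ℂ} (hf : IsHardy (-1) f g) :
    ∀ᵐ z : ℝ, Tendsto (fun ε : ℝ => f ((z : ℂ) - ε * Complex.I)) (𝓝[>] 0) (𝓝 (g z)) := by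
  filter_upwards [hf.boundary] with z hz
  refine (hz 0).comp (tendsto_nhdsWithin_iff.2 ⟨?_, ?_⟩)
  · have h : Continuous fun ε : ℝ => (z : ℂ) - ε * Complex.I := by fun_prop
    have := h.tendsto 0
    simp only [Complex.ofReal_zero, zero_mul, sub_zero] at this
    exact this.mono_left nhdsWithin_le_nhds
  · filter_upwards [self_mem_nhdsWithin] with ε hε
    have : 0 < ε := hε
    simpa [cone] using this

/-- The Plemelj projection `𝒫⁻` exists on `L²` and is given by an orthogonal projection. -/
lemma hasProjMinus_iff {h : ℝ → ℂ} (hh : MemLp h 2) {k : ℝ → ℂ} :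
    HasProjMinus h k ↔ k =ᵐ[volume] ⇑(-projLower (hh.toLp h)) := by
  have hlim := (isHardy_neg_one_cauchy (hh.toLp h)).tendsto_lower
  rw [cauchy_congr_ae hh.coeFn_toLp] at hlim
  constructor
  · intro hk
    filter_upwards [hk, hlim] with z hz hz'
    exact tendsto_nhds_unique hz hz'
  · intro hk
    unfold HasProjMinus
    filter_upwards [hk, hlim] with z hz hz'
    rwa [hz]

/-! ### Cauchy's formula for the Hardy class. -/

lemma isOpen_lt_im (c : ℝ) : IsOpen {w : ℂ | c < w.im} :=
  isOpen_lt continuous_const Complex.continuous_im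

/-- Cauchy's theorem for a half plane. -/
lemma integral_eq_zero_of_differentiableOn_upper {N : ℂ → ℂ} {c : ℝ} (hc : c < 0)
    (hN : DifferentiableOn ℂ N {w | c < w.im})
    (hdecay : Tendsto (fun w => w * N w) (Bornology.cobounded ℂ ⊓ 𝓟 {w | 0 ≤ w.im}) (𝓝 0))
    (hint : Integrable (fun t : ℝ => N t)) : ∫ t : ℝ, N t = 0 := by
  have hlim := intervalIntegral_tendsto_integral hint tendsto_neg_atTop_atBot tendsto_id
  refine tendsto_nhds_unique hlim ?_
  rw [Metric.tendsto_nhds]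
  intro ε hε
  have hev := (Metric.tendsto_nhds.1 hdecay (ε / 8) (by positivity))
  rw [eventually_inf_principal] at hev
  rw [← comap_norm_atTop, eventually_comap] at hev
  obtain ⟨R₀, hR₀⟩ := eventually_atTop.1 hev
  filter_upwards [eventually_ge_atTop R₀, eventually_gt_atTop 0] with R hR hR0
  have hbound : ∀ w : ℂ, R ≤ ‖w‖ → 0 ≤ w.im → ‖N w‖ ≤ ε / 8 / R := fun w hw hw0 => by
    have h1 := hR₀ ‖w‖ (hR.trans hw) w rfl hw0
    rw [dist_zero_right, norm_mul] at h1
    rw [le_div_iff₀ hR0]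
    nlinarith [norm_nonneg (N w)]
  -- Contour: the rectangle `[-R, R] × [0, R]`. With `|N| ≤ ε / (8R)` on its upper three sides, the
  -- top contributes at most `ε / 4` and each vertical side `ε / 8`.
  have hrect := Complex.integral_boundary_rect_eq_zero_of_differentiableOn N (-R : ℝ)
    (R + R * Complex.I) (hN.mono ?_)
  · have h1 : ‖∫ x : ℝ in (-R)..R, N (x + R * Complex.I)‖ ≤ ε / 8 / R * |R - -R| := by
      refine intervalIntegral.norm_integral_le_of_norm_le_const fun x _ => hbound _ ?_ ?_
      · have := Complex.abs_im_le_norm ((x : ℂ) + R * Complex.I)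
        simp only [Complex.add_im, Complex.ofReal_im, Complex.mul_im, Complex.ofReal_re,
          Complex.I_im, Complex.I_re, mul_one, mul_zero, add_zero, zero_add] at this
        exact (le_abs_self R).trans this
      · simpa using hR0.le
    have h2 : ∀ σ : ℝ, |σ| = R →
        ‖∫ y : ℝ in (0)..R, N (σ + y * Complex.I)‖ ≤ ε / 8 / R * |R - 0| := fun σ hσ => by
      refine intervalIntegral.norm_integral_le_of_norm_le_const fun y hy => hbound _ ?_ ?_
      · have := Complex.abs_re_le_norm ((σ : ℂ) + y * Complex.I)
        simp only [Complex.add_re, Complex.ofReal_re, Complex.mul_re, Complex.ofReal_im,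
          Complex.I_im, Complex.I_re, mul_one, mul_zero, sub_self, add_zero] at this
        exact hσ.symm.le.trans this
      · rw [Set.uIoc_of_le hR0.le] at hy
        simpa using hy.1.le
    simp only [Complex.ofReal_re, Complex.add_re, Complex.mul_re, Complex.I_re, mul_zero,
      Complex.ofReal_im, Complex.I_im, mul_one, sub_self, add_zero, Complex.add_im,
      Complex.mul_im, zero_add, Complex.ofReal_zero, zero_mul] at hrect
    have h3 := h2 R (abs_of_pos hR0)
    have h4 := h2 (-R) (by rw [abs_neg, abs_of_pos hR0])
    have h5 : ∫ x : ℝ in (-R)..R, N x = (∫ x : ℝ in (-R)..R, N (x + R * Complex.I)) -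
        Complex.I • (∫ y : ℝ in (0)..R, N (R + y * Complex.I)) +
        Complex.I • (∫ y : ℝ in (0)..R, N ((-R : ℝ) + y * Complex.I)) := by
      linear_combination hrect
    rw [dist_zero_right, id_eq, h5]
    refine (norm_add_le _ _).trans_lt ((add_le_add_left (norm_sub_le _ _) _).trans_lt ?_)
    rw [norm_smul, norm_smul, Complex.norm_I, one_mul, one_mul]
    rw [sub_neg_eq_add, abs_of_pos (by linarith)] at h1
    rw [sub_zero, abs_of_pos hR0] at h3 h4
    have h6 : ε / 8 / R * R = ε / 8 := by field_simp
    nlinarith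
  · intro w hw
    rw [Complex.mem_reProdIm] at hw
    have h1 := hw.2
    simp only [Complex.ofReal_im, Complex.add_im, Complex.mul_im, Complex.ofReal_re,
      Complex.I_im, Complex.I_re, mul_one, mul_zero, add_zero, zero_add] at h1
    rw [Set.uIcc_of_le hR0.le] at h1
    exact hc.trans_le h1.1

lemma tendsto_mul_inv_sub_cobounded (a : ℂ) (s : Set ℂ) :
    Tendsto (fun w : ℂ => w * (w - a)⁻¹) (Bornology.cobounded ℂ ⊓ 𝓟 s) (𝓝 1) := by
  refine Tendsto.mono_left ?_ inf_le_left
  have h1 : Tendsto (fun w : ℂ => (w - a)⁻¹) (Bornology.cobounded ℂ) (𝓝 0) :=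
    tendsto_inv₀_cobounded.comp (tendsto_sub_const_cobounded a)
  have h2 := (h1.const_mul a).const_add 1
  rw [mul_zero, add_zero] at h2
  refine h2.congr' ?_
  filter_upwards [Bornology.eventually_ne_cobounded a] with w hw
  have : w - a ≠ 0 := sub_ne_zero.2 hw
  field_simp
  ring

/-- The pole `η` lies below the contour, and the factor `(w - η)⁻¹` together with the decay of `F`
makes the integrand `o(1/w)`, so Cauchy's theorem applies. -/
lemma cauchy_restrict_eq_zero {F : ℂ → ℂ} {c : ℝ} (hc : c < 0)
    (hF : DifferentiableOn ℂ F {w | c < w.im})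
    (hdecay : Tendsto F (Bornology.cobounded ℂ ⊓ 𝓟 {w | 0 ≤ w.im}) (𝓝 0))
    (hL2 : MemLp (fun t : ℝ => F t) 2) {η : ℂ} (hη : η.im < 0) :
    cauchy (fun t => F t) η = 0 := by
  rw [cauchy_eq]
  have h := integral_eq_zero_of_differentiableOn_upper (N := fun w => (w - η)⁻¹ * F w)
    (max_lt hc hη) ?_ ?_ (integrable_cauchyKernel_mul hL2 hη.ne)
  · simp only [cauchyKernel]
    rw [h, mul_zero]
  · refine DifferentiableOn.mul (DifferentiableOn.inv (by fun_prop) fun w hw h0 => ?_)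
      (hF.mono fun w hw => show c < w.im from (le_max_left _ _).trans_lt hw)
    have h1 : max c η.im < w.im := hw
    have h2 := congrArg Complex.im h0
    rw [Complex.sub_im, Complex.zero_im] at h2
    linarith [le_max_right c η.im]
  · have := (tendsto_mul_inv_sub_cobounded η {w : ℂ | 0 ≤ w.im}).mul hdecay
    rw [mul_zero] at this
    exact this.congr fun w => mul_assoc _ _ _

/-- Subtract the multiple `a / (w - conj ζ)` that agrees with `F` at `ζ`. The difference `M`
vanishes at `ζ`, so `M / (w - ζ)` has a removable singularity and integrates to zero. The subtracted
term is explicit: against the Cauchy kernel it produces `F ζ` times the Poisson kernel, of mass one.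
-/
lemma cauchy_restrict_eq {F : ℂ → ℂ} {c : ℝ} (hc : c < 0)
    (hF : DifferentiableOn ℂ F {w | c < w.im})
    (hdecay : Tendsto F (Bornology.cobounded ℂ ⊓ 𝓟 {w | 0 ≤ w.im}) (𝓝 0))
    (hL2 : MemLp (fun t : ℝ => F t) 2) {ζ : ℂ} (hζ : 0 < ζ.im) :
    cauchy (fun t => F t) ζ = F ζ := by
  have hζ' : (conj ζ).im < 0 := by simpa using hζ
  set a : ℂ := F ζ * (ζ - conj ζ) with ha
  set M : ℂ → ℂ := fun w => F w - a * (w - conj ζ)⁻¹ with hM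
  have hMζ : M ζ = 0 := by
    have : ζ - conj ζ ≠ 0 := fun h => by
      have := congrArg Complex.im h
      simp at this
      linarith
    simp only [hM, ha]
    field_simp
    simp
  have hMd : DifferentiableOn ℂ M {w | max c (conj ζ).im < w.im} := by
    refine DifferentiableOn.sub (hF.mono fun w hw => show c < w.im from (le_max_left _ _).trans_lt hw)
      (DifferentiableOn.const_mul (DifferentiableOn.inv (by fun_prop) fun w hw h0 => ?_) _)
    have h1 : max c (conj ζ).im < w.im := hw
    have h2 := congrArg Complex.im h0
    rw [Complex.sub_im, Complex.zero_im] at h2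
    linarith [le_max_right c (conj ζ).im]
  have hMdecay : Tendsto M (Bornology.cobounded ℂ ⊓ 𝓟 {w | 0 ≤ w.im}) (𝓝 0) := by
    have h1 : Tendsto (fun w : ℂ => (w - conj ζ)⁻¹) (Bornology.cobounded ℂ) (𝓝 0) :=
      tendsto_inv₀_cobounded.comp (tendsto_sub_const_cobounded _)
    have h2 := hdecay.sub ((h1.const_mul a).mono_left inf_le_left)
    rwa [mul_zero, sub_zero] at h2
  have hkL2 : MemLp (fun t => a * cauchyKernel (conj ζ) t) 2 :=
    (memLp_cauchyKernel hζ'.ne).const_mul a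
  have hML2 : MemLp (fun t : ℝ => M t) 2 := hL2.sub hkL2
  have hslope : ∀ w, w ≠ ζ → dslope M ζ w = (w - ζ)⁻¹ * M w := fun w hw => by
    rw [dslope_of_ne _ hw, slope_def_field, hMζ, sub_zero, div_eq_inv_mul]
  have hreal : ∀ t : ℝ, dslope M ζ t = cauchyKernel ζ t * M t := fun t =>
    hslope t fun h => ofReal_sub_ne_zero hζ.ne' t (sub_eq_zero.2 h)
  have hzero : ∫ t : ℝ, cauchyKernel ζ t * M t = 0 := by
    simp_rw [← hreal]
    refine integral_eq_zero_of_differentiableOn_upper (max_lt hc hζ')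
      ((Complex.differentiableOn_dslope ((isOpen_lt_im _).mem_nhds ?_)).2 hMd) ?_ ?_
    · exact (max_lt hc hζ').trans hζ
    · have := (tendsto_mul_inv_sub_cobounded ζ {w : ℂ | 0 ≤ w.im}).mul hMdecay
      rw [mul_zero] at this
      refine this.congr' ?_
      filter_upwards [mem_inf_of_left (Bornology.eventually_ne_cobounded ζ)] with w hw
      rw [hslope w hw, mul_assoc]
    · simp_rw [hreal]
      exact integrable_cauchyKernel_mul hML2 hζ.ne'
  have hsub : cauchy (fun t => F t) ζ = cauchy (fun t => a * cauchyKernel (conj ζ) t) ζ := by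
    rw [← sub_eq_zero, ← cauchy_sub hL2 hkL2 hζ.ne', cauchy_eq]
    exact mul_eq_zero_of_right _ hzero
  rw [hsub, cauchy_eq, ← integral_const_mul]
  have hpt : ∀ t : ℝ, (2 * Real.pi * Complex.I)⁻¹ *
      (cauchyKernel ζ t * (a * cauchyKernel (conj ζ) t)) = F ζ * halfPlanePoisson ζ t := fun t => by
    rw [← cauchyKernel_sub_conj hζ]
    have h1 := ofReal_sub_ne_zero hζ.ne' t
    have h2 := ofReal_sub_ne_zero hζ'.ne t
    simp only [cauchyKernel, ha]
    rw [inv_sub_inv h1 h2]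
    field_simp
    ring
  simp_rw [hpt]
  rw [integral_const_mul, integral_complex_ofReal, integral_halfPlanePoisson hζ]
  simp

lemma IsHardy.continuous_line {s : ℤˣ} {f : ℂ → ℂ} {g : ℝ → ℂ} (hf : IsHardy s f g) {y : ℝ}
    (hy : 0 < y) : Continuous (fun t : ℝ => f ((t : ℂ) + ((s : ℤ) : ℂ) * y * Complex.I)) := by
  refine hf.analytic.continuousOn.comp_continuous (by fun_prop) fun t => ?_
  rcases Int.units_eq_one_or s with rfl | rfl <;> simpa [halfPlane] using hy

lemma IsHardy.memLp_line {s : ℤˣ} {f : ℂ → ℂ} {g : ℝ → ℂ} (hf : IsHardy s f g) {y : ℝ}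
    (hy : 0 < y) : MemLp (fun t : ℝ => f ((t : ℂ) + ((s : ℤ) : ℂ) * y * Complex.I)) 2 := by
  obtain ⟨C, hC⟩ := hf.bounded
  exact ⟨(hf.continuous_line hy).aestronglyMeasurable, (hC y hy).trans_lt ENNReal.coe_lt_top⟩

/-- Vertical shift of a function of Hardy class in the upper half plane. -/
lemma IsHardy.shift {f : ℂ → ℂ} {g : ℝ → ℂ} (hf : IsHardy 1 f g) {y : ℝ} (hy : 0 < y) :
    DifferentiableOn ℂ (fun w => f (w + y * Complex.I)) {w | -y < w.im} ∧
    Tendsto (fun w => f (w + y * Complex.I)) (Bornology.cobounded ℂ ⊓ 𝓟 {w | 0 ≤ w.im}) (𝓝 0) ∧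
    MemLp (fun t : ℝ => f (t + y * Complex.I)) 2 := by
  refine ⟨?_, ?_, ?_⟩
  · refine hf.analytic.comp (by fun_prop) fun w hw => ?_
    have hw : -y < w.im := hw
    simp [halfPlane]
    linarith
  · refine (hf.decay y hy).comp (tendsto_inf.2 ⟨?_, ?_⟩)
    · exact (tendsto_add_const_cobounded _).mono_left inf_le_left
    · refine tendsto_principal.2 ?_
      filter_upwards [mem_inf_of_right (mem_principal_self _)] with w hw
      have hw : 0 ≤ w.im := hw
      simpa using hw
  · simpa using hf.memLp_line hy

/-- The shifted traces are bounded in `L²` and converge almost everywhere, hence weakly; the Cauchy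
kernel is the test function. This carries Cauchy's formula from interior lines to the boundary. -/
lemma IsHardy.tendsto_cauchy_shift {f : ℂ → ℂ} {g : ℝ → ℂ} (hf : IsHardy 1 f g) {ζ : ℂ}
    (hζ : ζ.im ≠ 0) :
    Tendsto (fun y : ℝ => cauchy (fun t => f ((t : ℂ) + y * Complex.I)) ζ) (𝓝[>] 0)
      (𝓝 (cauchy g ζ)) := by
  obtain ⟨C, hC⟩ := hf.bounded
  simp_rw [cauchy_eq, mul_comm (cauchyKernel ζ _)]
  refine (tendsto_integral_mul_of_bounded (C := C) ?_ hf.boundary_memLp ?_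
    (memLp_cauchyKernel hζ)).const_mul _
  · filter_upwards [self_mem_nhdsWithin] with y hy
    exact ⟨(hf.shift hy).2.2, by simpa using hC y hy⟩
  · filter_upwards [hf.boundary] with t ht
    refine (ht 0).comp (tendsto_nhdsWithin_iff.2 ⟨?_, ?_⟩)
    · have h : Continuous fun y : ℝ => (t : ℂ) + y * Complex.I := by fun_prop
      have := h.tendsto 0
      simp only [Complex.ofReal_zero, zero_mul, add_zero] at this
      exact this.mono_left nhdsWithin_le_nhds
    · filter_upwards [self_mem_nhdsWithin] with y hy
      have : 0 < y := hy
      simpa [cone] using this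

/-- Cauchy's formula for the Hardy class of the upper half plane. -/
lemma IsHardy.cauchy_eq_of_im_pos {f : ℂ → ℂ} {g : ℝ → ℂ} (hf : IsHardy 1 f g) {ζ : ℂ}
    (hζ : 0 < ζ.im) : cauchy g ζ = f ζ := by
  refine tendsto_nhds_unique (hf.tendsto_cauchy_shift hζ.ne') ?_
  have h1 : Tendsto (fun y : ℝ => f (ζ + y * Complex.I)) (𝓝[>] 0) (𝓝 (f ζ)) := by
    have hopen : IsOpen (halfPlane 1) := by simpa [halfPlane] using isOpen_lt_im 0
    have h2 : ContinuousAt f ζ :=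
      (hf.analytic.differentiableAt (hopen.mem_nhds (by simpa [halfPlane] using hζ))).continuousAt
    refine h2.tendsto.comp ?_
    have h : Continuous fun y : ℝ => ζ + y * Complex.I := by fun_prop
    have := h.tendsto 0
    simp only [Complex.ofReal_zero, zero_mul, add_zero] at this
    exact this.mono_left nhdsWithin_le_nhds
  refine h1.congr' ?_
  filter_upwards [self_mem_nhdsWithin] with y hy
  have hy : 0 < y := hy
  obtain ⟨h2, h3, h4⟩ := hf.shift hy
  exact (cauchy_restrict_eq (neg_neg_iff_pos.2 hy) h2 h3 h4 hζ).symm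

lemma IsHardy.cauchy_eq_zero_of_im_neg {f : ℂ → ℂ} {g : ℝ → ℂ} (hf : IsHardy 1 f g) {ζ : ℂ}
    (hζ : ζ.im < 0) : cauchy g ζ = 0 := by
  refine tendsto_nhds_unique (hf.tendsto_cauchy_shift hζ.ne) ?_
  refine tendsto_const_nhds.congr' ?_
  filter_upwards [self_mem_nhdsWithin] with y hy
  have hy : 0 < y := hy
  obtain ⟨h2, h3, h4⟩ := hf.shift hy
  exact (cauchy_restrict_eq_zero (neg_neg_iff_pos.2 hy) h2 h3 h4 hζ).symm

/-- The reflection `ζ ↦ -ζ` exchanges the Hardy classes of the two half planes. -/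
lemma IsHardy.comp_neg {f : ℂ → ℂ} {g : ℝ → ℂ} (hf : IsHardy (-1) f g) :
    IsHardy 1 (fun ζ => f (-ζ)) (fun t => g (-t)) where
  analytic := by
    refine hf.analytic.comp (by fun_prop) fun w hw => ?_
    simpa [halfPlane] using hw
  bounded := by
    obtain ⟨C, hC⟩ := hf.bounded
    refine ⟨C, fun y hy => le_trans (le_of_eq ?_) (hC y hy)⟩
    rw [← eLpNorm_comp_measurePreserving (hf.continuous_line hy).aestronglyMeasurable
      (Measure.measurePreserving_neg (volume : Measure ℝ))]
    congr 1 with t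
    simp
    ring_nf
  decay := fun δ hδ => by
    refine (hf.decay δ hδ).comp (tendsto_inf.2 ⟨?_, ?_⟩)
    · exact tendsto_neg_cobounded.mono_left inf_le_left
    · refine tendsto_principal.2 ?_
      filter_upwards [mem_inf_of_right (mem_principal_self _)] with w hw
      simpa using hw
  boundary_memLp := hf.boundary_memLp.comp_measurePreserving
    (Measure.measurePreserving_neg (volume : Measure ℝ))
  boundary := by
    filter_upwards [(Measure.measurePreserving_neg
      (volume : Measure ℝ)).quasiMeasurePreserving.ae hf.boundary] with t ht k
    refine (ht k).comp (tendsto_nhdsWithin_iff.2 ⟨?_, ?_⟩)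
    · have := (continuous_neg.tendsto (t : ℂ)).mono_left
        (nhdsWithin_le_nhds (s := cone 1 k t))
      simpa using this
    · filter_upwards [self_mem_nhdsWithin] with w hw
      simp only [cone, Units.val_one, Int.cast_one, one_mul, Set.mem_ofPred_eq, Units.val_neg,
        Int.cast_neg, Complex.neg_im, Complex.neg_re, mul_neg, neg_mul, neg_neg] at hw ⊢
      rwa [neg_sub_neg, abs_sub_comm]

lemma cauchy_comp_neg (g : ℝ → ℂ) (ζ : ℂ) : cauchy (fun t => g (-t)) ζ = -cauchy g (-ζ) := by
  rw [cauchy_eq, cauchy_eq, ← mul_neg, ← integral_neg,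
    ← integral_neg_eq_self (fun t => cauchyKernel ζ t * g (-t))]
  congr 2 with t
  rw [neg_neg, ← neg_mul, cauchyKernel, cauchyKernel, ← inv_neg]
  push_cast
  ring_nf

/-- Transported from the upper half plane by `ζ ↦ -ζ`, which unlike conjugation preserves
analyticity. The sign is that of `cauchy_comp_neg`. -/
lemma IsHardy.cauchy_eq_neg_of_im_neg {f : ℂ → ℂ} {g : ℝ → ℂ} (hf : IsHardy (-1) f g) {ζ : ℂ}
    (hζ : ζ.im < 0) : cauchy g ζ = -f ζ := by
  have h := hf.comp_neg.cauchy_eq_of_im_pos (ζ := -ζ) (by simpa using hζ)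
  rw [cauchy_comp_neg, neg_neg] at h
  rw [← h, neg_neg]

lemma IsHardy.cauchy_eq_zero_of_im_pos {f : ℂ → ℂ} {g : ℝ → ℂ} (hf : IsHardy (-1) f g) {ζ : ℂ}
    (hζ : 0 < ζ.im) : cauchy g ζ = 0 := by
  have h := hf.comp_neg.cauchy_eq_zero_of_im_neg (ζ := -ζ) (by simpa using hζ)
  rwa [cauchy_comp_neg, neg_neg, neg_eq_zero] at h

/-! ### Boundedness of `H¹` functions. -/

open scoped FourierTransform in
/-- The Sobolev embedding `H¹(ℝ) ⊂ L^∞(ℝ)`. -/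
lemma MemH1.exists_bound {f : ℝ → ℂ} (hf : MemH1 f) : ∃ C : ℝ, ∀ᵐ z : ℝ, ‖f z‖ ≤ C := by
  obtain ⟨hf2, hs⟩ := hf
  obtain ⟨v, hv⟩ := hs.fourier_memL1 (by norm_num)
  have hvi : Integrable (v : ℝ → ℂ) := memLp_one_iff_integrable.1 (Lp.memLp v)
  -- `v` is the distributional Fourier transform of `f` and is integrable, so its inverse transform
  -- `W` is continuous and bounded by the `L¹` norm of `v`. Testing against smooth compactly
  -- supported functions identifies `W` with `f`.
  set W : ℝ → ℂ := VectorFourier.fourierIntegral Real.fourierChar volume (-innerₗ ℝ).flip v with hW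
  have hWc : Continuous W := VectorFourier.fourierIntegral_continuous Real.continuous_fourierChar
    (by simp; fun_prop) hvi
  refine ⟨∫ t, ‖v t‖, ?_⟩
  have hae : (hf2.toLp f : ℝ → ℂ) =ᵐ[volume] W := by
    refine ae_eq_of_integral_contDiff_smul_eq ((Lp.memLp _).locallyIntegrable (by norm_num))
      hWc.locallyIntegrable fun g hg hgc => ?_
    have hg1 : HasCompactSupport (Complex.ofRealCLM ∘ g) := hgc.comp_left rfl
    have hg2 : ContDiff ℝ (⊤ : ℕ∞) (Complex.ofRealCLM ∘ g) := by fun_prop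
    set φ : 𝓢(ℝ, ℂ) := hg1.toSchwartzMap hg2 with hφ
    have h1 : ((hf2.toLp f : Lp ℂ 2 (volume : Measure ℝ)) : 𝓢'(ℝ, ℂ)) φ =
        (v : 𝓢'(ℝ, ℂ)) (𝓕⁻ φ) := by
      rw [← hv, TemperedDistribution.fourier_apply, FourierTransform.fourier_fourierInv_eq]
    rw [Lp.toTemperedDistribution_apply, Lp.toTemperedDistribution_apply] at h1
    have h2 := VectorFourier.integral_fourierIntegral_smul_eq_flip (μ := volume) (ν := volume)
      (L := -innerₗ ℝ) (f := (φ : ℝ → ℂ)) (g := (v : ℝ → ℂ)) Real.continuous_fourierChar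
      (by simp; fun_prop) φ.integrable hvi
    have h3 : ((𝓕⁻ φ : 𝓢(ℝ, ℂ)) : ℝ → ℂ) =
        VectorFourier.fourierIntegral Real.fourierChar volume (-innerₗ ℝ) φ := by
      rw [SchwartzMap.fourierInv_coe]
      rfl
    rw [h3, h2] at h1
    simpa [hφ] using h1
  filter_upwards [hf2.coeFn_toLp, hae] with z h1 h2
  rw [← h1, h2]
  exact VectorFourier.norm_fourierIntegral_le_integral_norm _ _ _ _ _

/-! ### Coercive perturbations composed with an orthogonal projection. -/

section Abstract

variable {H : Type*} [NormedAddCommGroup H] [InnerProductSpace ℂ H]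

/-- The Lax--Milgram theorem: a coercive operator is surjective. -/
lemma surjective_of_coercive [CompleteSpace H] {B : H →L[ℂ] H} {c : ℝ} (hc : 0 < c)
    (hB : ∀ u, c * ‖u‖ ^ 2 ≤ (inner ℂ u (B u)).re) : Function.Surjective B := by
  have hbound : ∀ u, c * ‖u‖ ≤ ‖B u‖ := fun u => by
    rcases eq_or_ne u 0 with rfl | hu
    · simp
    · have h1 := (hB u).trans ((Complex.re_le_norm _).trans (norm_inner_le_norm u (B u)))
      have h2 := norm_pos_iff.2 hu
      nlinarith
  have hanti : AntilipschitzWith (Real.toNNReal c⁻¹) B :=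
    B.antilipschitz_of_bound fun u => by
      rw [Real.coe_toNNReal _ (by positivity), inv_mul_eq_div, le_div_iff₀' hc]
      exact hbound u
  have hclosed : IsClosed (B.range : Set H) := by
    rw [LinearMap.coe_range]
    exact hanti.isClosed_range B.uniformContinuous
  have : CompleteSpace B.range := hclosed.completeSpace_coe
  suffices htop : B.range = ⊤ from LinearMap.range_eq_top.1 htop
  rw [← Submodule.orthogonal_eq_bot_iff, Submodule.eq_bot_iff]
  intro u hu
  have h1 : inner ℂ u (B u) = 0 := Submodule.inner_left_of_mem_orthogonal
    (LinearMap.mem_range_self (B : H →ₗ[ℂ] H) u) hu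
  have h2 := hB u
  rw [h1, Complex.zero_re] at h2
  have h3 : ‖u‖ ^ 2 ≤ 0 := by nlinarith
  simpa using le_antisymm h3 (by positivity)

/-- The equation puts `u` in the range of `Q`, so `⟨u, u + A u⟩ = ⟨u, u + Q A u⟩ = 0`, and
coercivity forces `u = 0`. -/
lemma injective_add_proj_comp {Q A : H →L[ℂ] H} (hQ : ∀ u, Q (Q u) = Q u)
    (hsymm : ∀ u v, inner ℂ (Q u) v = inner ℂ u (Q v)) {c : ℝ} (hc : 0 < c)
    (hA : ∀ u, c * ‖u‖ ^ 2 ≤ (inner ℂ u (u + A u)).re) {u : H} (hu : u + Q (A u) = 0) : u = 0 := by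
  have h1 : Q u = u := by
    have h := eq_neg_of_add_eq_zero_left hu
    rw [h, map_neg, hQ]
  have h2 : inner ℂ u (u + A u) = 0 := by
    rw [inner_add_right]
    nth_rewrite 3 [← h1]
    rw [hsymm, ← inner_add_right, hu, inner_zero_right]
  have h3 := hA u
  rw [h2, Complex.zero_re] at h3
  have h4 : ‖u‖ ^ 2 ≤ 0 := by nlinarith
  simpa using le_antisymm h4 (by positivity)

/-- Coercivity of `I + A` need not pass to `I + QA`, but `I + QAQ` inherits it: its form at `u` is
`‖u - Qu‖²` plus the form of `I + A` at `Qu`, whence the constant `min c 1`. The component `f - Qf`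
is kept as it is and only a correction `w` in the range of `Q` is solved for. -/
lemma surjective_add_proj_comp [CompleteSpace H] {Q A : H →L[ℂ] H} (hQ : ∀ u, Q (Q u) = Q u)
    (hsymm : ∀ u v, inner ℂ (Q u) v = inner ℂ u (Q v)) {c : ℝ} (hc : 0 < c)
    (hA : ∀ u, c * ‖u‖ ^ 2 ≤ (inner ℂ u (u + A u)).re) (f : H) : ∃ u, u + Q (A u) = f := by
  have hcoer : ∀ u, min c 1 * ‖u‖ ^ 2 ≤
      (inner ℂ u ((ContinuousLinearMap.id ℂ H + Q ∘L A ∘L Q) u)).re := fun u => by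
    have horth : inner ℂ (Q u) (u - Q u) = 0 := by
      rw [hsymm, map_sub, hQ, sub_self, inner_zero_right]
    have hpyth : ‖u‖ ^ 2 = ‖Q u‖ ^ 2 + ‖u - Q u‖ ^ 2 := by
      have h := norm_add_sq_eq_norm_sq_add_norm_sq_of_inner_eq_zero (Q u) (u - Q u) horth
      rw [add_sub_cancel] at h
      nlinarith
    have h1 : (inner ℂ u u).re = ‖u‖ ^ 2 := by
      rw [inner_self_eq_norm_sq_to_K]
      norm_cast
    have h2 : (inner ℂ (Q u) (Q u)).re = ‖Q u‖ ^ 2 := by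
      rw [inner_self_eq_norm_sq_to_K]
      norm_cast
    have h3 := hA (Q u)
    rw [inner_add_right, Complex.add_re, h2] at h3
    have h4 : (inner ℂ u ((ContinuousLinearMap.id ℂ H + Q ∘L A ∘L Q) u)).re =
        ‖u‖ ^ 2 + (inner ℂ (Q u) (A (Q u))).re := by
      rw [add_apply, inner_add_right, Complex.add_re,
        ContinuousLinearMap.id_apply, h1, hsymm]
      rfl
    rw [h4, hpyth]
    nlinarith [min_le_left c 1, min_le_right c 1, sq_nonneg ‖Q u‖, sq_nonneg ‖u - Q u‖]
  -- The right-hand side lies in the range of `Q`, which forces `Q w = w`; its second term cancels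
  -- the image of `f - Q f` under `QA`.
  obtain ⟨w, hw⟩ := surjective_of_coercive (lt_min hc one_pos) hcoer (Q f - Q (A (f - Q f)))
  have hw' : w + Q (A (Q w)) = Q f - Q (A (f - Q f)) := hw
  have hQw : Q w = w := by
    have h := congrArg Q hw'
    simp only [map_add, map_sub, hQ] at h
    simp only [map_sub] at hw'
    exact add_right_cancel (h.trans hw'.symm)
  refine ⟨f - Q f + w, ?_⟩
  rw [hQw] at hw'
  rw [map_add A, map_add Q, add_comm (Q (A (f - Q f))), ← add_assoc, add_assoc (f - Q f), hw']
  abel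

end Abstract

/-! ### The integral equation for a single row. -/

/-- Multiplication by an essentially bounded function on `L²(ℝ)`. -/
def mulLp {φ : ℝ → ℂ} (hφ : MemLp φ ∞) : L2 →L[ℂ] L2 :=
  (ContinuousLinearMap.mul ℂ ℂ).holderL volume ∞ 2 2 (hφ.toLp φ)

lemma coeFn_mulLp {φ : ℝ → ℂ} (hφ : MemLp φ ∞) (u : L2) :
    ⇑(mulLp hφ u) =ᵐ[volume] fun t => φ t * u t := by
  filter_upwards [ContinuousLinearMap.coeFn_holder (r := 2) (ContinuousLinearMap.mul ℂ ℂ)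
    (hφ.toLp φ) u, hφ.coeFn_toLp] with t h1 h2
  rw [← h2]
  exact h1

/-- The space of row vectors with entries in `L²(ℝ)`. -/
abbrev RowL2 : Type := PiLp 2 (fun _ : Fin 2 => L2)

/-- The operator on row vectors with the given matrix of operators, acting on the right. -/
def rowOp (M : Fin 2 → Fin 2 → L2 →L[ℂ] L2) : RowL2 →L[ℂ] RowL2 :=
  ((PiLp.continuousLinearEquiv 2 ℂ (fun _ : Fin 2 => L2)).symm : (Fin 2 → L2) →L[ℂ] RowL2) ∘L
    ContinuousLinearMap.pi (fun j => ∑ k, M k j ∘L PiLp.proj 2 (fun _ : Fin 2 => L2) k)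

lemma rowOp_apply (M : Fin 2 → Fin 2 → L2 →L[ℂ] L2) (u : RowL2) (j : Fin 2) :
    rowOp M u j = ∑ k, M k j (u k) := by
  simp [rowOp]

/-- `projLower` acting on each entry of a row vector. -/
def rowProj : RowL2 →L[ℂ] RowL2 := rowOp fun k j => if k = j then projLower else 0

lemma rowProj_apply (u : RowL2) (j : Fin 2) : rowProj u j = projLower (u j) := by
  rw [rowProj, rowOp_apply, Finset.sum_eq_single j]
  · simp
  · intro b _ hb
    simp [hb]
  · simp

/-- The pointwise coercivity of `v ↦ v + v σ(z)`. -/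
def RowCoercive (c : ℝ) (σ : ℝ → Matrix (Fin 2) (Fin 2) ℂ) : Prop :=
  ∀ᵐ z : ℝ, ∀ v : Fin 2 → ℂ, c * ∑ j, ‖v j‖ ^ 2 ≤
    (∑ j, conj (v j) * (v j + ∑ k, v k * σ z k j)).re

lemma coeFn_sum_mulLp {σ : ℝ → Matrix (Fin 2) (Fin 2) ℂ}
    (hσ : ∀ k j, MemLp (fun z => σ z k j) ∞) (u : Fin 2 → L2) (j : Fin 2) :
    ⇑(∑ k, mulLp (hσ k j) (u k)) =ᵐ[volume] fun t => ∑ k, u k t * σ t k j := by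
  simp only [Fin.sum_univ_two]
  filter_upwards [Lp.coeFn_add (mulLp (hσ 0 j) (u 0)) (mulLp (hσ 1 j) (u 1)),
    coeFn_mulLp (hσ 0 j) (u 0), coeFn_mulLp (hσ 1 j) (u 1)] with t h1 h2 h3
  rw [h1, Pi.add_apply, h2, h3]
  ring

/-- The inner product of rows is the integral of the pointwise one, so the pointwise inequality need
only be integrated. -/
lemma coercive_rowOp_mulLp {c : ℝ} {σ : ℝ → Matrix (Fin 2) (Fin 2) ℂ}
    (hσ : ∀ k j, MemLp (fun z => σ z k j) ∞) (hco : RowCoercive c σ) (u : RowL2) :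
    c * ‖u‖ ^ 2 ≤ (inner ℂ u (u + rowOp (fun k j => mulLp (hσ k j)) u)).re := by
  set w := u + rowOp (fun k j => mulLp (hσ k j)) u with hw
  have hint : ∀ a b : L2, Integrable (fun t => conj (a t) * b t) := fun a b => by
    simpa only [RCLike.inner_apply'] using L2.integrable_inner (𝕜 := ℂ) a b
  have hinner : ∀ a b : RowL2, inner ℂ a b = ∫ t, ∑ j, conj (a j t) * b j t := fun a b => by
    rw [PiLp.inner_apply, integral_finsetSum _ fun j _ => hint (a j) (b j)]
    simp only [L2.inner_def, RCLike.inner_apply']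
  have hnorm : c * ‖u‖ ^ 2 = ∫ t, c * ∑ j, ‖u j t‖ ^ 2 := by
    have h1 : ‖u‖ ^ 2 = (inner ℂ u u).re := by
      rw [inner_self_eq_norm_sq_to_K]
      norm_cast
    rw [h1, hinner, integral_const_mul]
    congr 1
    have h2 : ∀ t, ∑ j, conj (u j t) * u j t = ((∑ j, ‖u j t‖ ^ 2 : ℝ) : ℂ) := fun t => by
      push_cast
      exact Finset.sum_congr rfl fun j _ => Complex.conj_mul' _
    simp_rw [h2]
    rw [integral_complex_ofReal, Complex.ofReal_re]
  have hre : (inner ℂ u w).re = ∫ t, (∑ j, conj (u j t) * w j t).re := by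
    rw [hinner]
    exact (integral_re (𝕜 := ℂ) (integrable_finsetSum _ fun j _ => hint (u j) (w j))).symm
  rw [hnorm, hre]
  refine integral_mono_ae ?_ ?_ ?_
  · refine Integrable.const_mul (integrable_finsetSum _ fun j _ => ?_) _
    exact (memLp_two_iff_integrable_sq_norm (Lp.aestronglyMeasurable _)).1 (Lp.memLp (u j))
  · have hi : Integrable (fun t => ∑ j, conj (u j t) * w j t) :=
      integrable_finsetSum _ fun j _ => hint (u j) (w j)
    exact hi.re
  · have hwj : ∀ j, ∀ᵐ t, w j t = u j t + ∑ k, u k t * σ t k j := fun j => by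
      have h1 : w j = u j + ∑ k, mulLp (hσ k j) (u k) := by
        rw [hw, PiLp.add_apply, rowOp_apply]
      rw [h1]
      filter_upwards [Lp.coeFn_add (u j) (∑ k, mulLp (hσ k j) (u k)),
        coeFn_sum_mulLp hσ u j] with t h2 h3
      rw [h2, Pi.add_apply, h3]
    filter_upwards [hco, hwj 0, hwj 1] with t h1 h2 h3
    refine (h1 fun j => u j t).trans_eq ?_
    simp only [Fin.sum_univ_two] at h2 h3 ⊢
    rw [h2, h3]

lemma memLp_sum_mul {σ : ℝ → Matrix (Fin 2) (Fin 2) ℂ} (hσ : ∀ k j, MemLp (fun z => σ z k j) ∞)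
    {u : ℝ → Fin 2 → ℂ} (hu : ∀ j, MemLp (fun z => u z j) 2) (j : Fin 2) :
    MemLp (fun t => ∑ k, u t k * σ t k j) 2 :=
  memLp_finsetSum _ fun k _ => (hσ k j).mul (hu k)

lemma HasProjMinus.congr_ae {h h' k k' : ℝ → ℂ} (H : HasProjMinus h k) (hh : h =ᵐ[volume] h')
    (hk : k =ᵐ[volume] k') : HasProjMinus h' k' := by
  unfold HasProjMinus at H ⊢
  rw [← cauchy_congr_ae hh]
  filter_upwards [H, hk] with z hz hz'
  rwa [← hz']

lemma HasProjMinus.add {h h' k k' : ℝ → ℂ} (hh : MemLp h 2) (hh' : MemLp h' 2)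
    (H : HasProjMinus h k) (H' : HasProjMinus h' k') :
    HasProjMinus (fun t => h t + h' t) (fun t => k t + k' t) := by
  filter_upwards [H, H'] with z hz hz'
  refine (hz.add hz').congr' ?_
  filter_upwards [self_mem_nhdsWithin] with ε hε
  refine (cauchy_add hh hh' ?_).symm
  have : (0 : ℝ) < ε := hε
  simpa using this.ne'

lemma HasProjMinus.sub {h h' k k' : ℝ → ℂ} (hh : MemLp h 2) (hh' : MemLp h' 2)
    (H : HasProjMinus h k) (H' : HasProjMinus h' k') :
    HasProjMinus (fun t => h t - h' t) (fun t => k t - k' t) := by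
  filter_upwards [H, H'] with z hz hz'
  refine (hz.sub hz').congr' ?_
  filter_upwards [self_mem_nhdsWithin] with ε hε
  refine (cauchy_sub hh hh' ?_).symm
  have : (0 : ℝ) < ε := hε
  simpa using this.ne'

/-- The row equation `u - 𝒫⁻(u σ) = f` is solvable in `L²`. -/
theorem exists_row_solution {c : ℝ} (hc : 0 < c) {σ : ℝ → Matrix (Fin 2) (Fin 2) ℂ}
    (hσ : ∀ k j, MemLp (fun z => σ z k j) ∞) (hco : RowCoercive c σ) {f : ℝ → Fin 2 → ℂ}
    (hf : ∀ j, MemLp (fun z => f z j) 2) :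
    ∃ u : ℝ → Fin 2 → ℂ, (∀ j, MemLp (fun z => u z j) 2) ∧
      ∀ j, HasProjMinus (fun t => ∑ k, u t k * σ t k j) (fun z => u z j - f z j) := by
  -- As `𝒫⁻ = -projLower`, the equation `u - 𝒫⁻(u σ) = f` is `u + Q(A u) = f` with `Q = rowProj`.
  obtain ⟨u, hu⟩ := surjective_add_proj_comp (Q := rowProj) (A := rowOp fun k j => mulLp (hσ k j))
    (fun u => by ext1 j; rw [rowProj_apply, rowProj_apply, projLower_projLower])
    (fun u v => by simp only [PiLp.inner_apply, rowProj_apply, inner_projLower]) hc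
    (coercive_rowOp_mulLp hσ hco) (WithLp.toLp 2 fun j => (hf j).toLp _)
  refine ⟨fun z j => u j z, fun j => Lp.memLp (u j), fun j => ?_⟩
  have h1 : u j + projLower (∑ k, mulLp (hσ k j) (u k)) = (hf j).toLp _ := by
    have := congrArg (fun v : RowL2 => v j) hu
    simpa only [PiLp.add_apply, rowProj_apply, rowOp_apply] using this
  have h2 : (memLp_sum_mul hσ (u := fun z j => u j z) (fun j => Lp.memLp (u j)) j).toLp _ =
      ∑ k, mulLp (hσ k j) (u k) := by
    refine Lp.ext ((MemLp.coeFn_toLp _).trans (coeFn_sum_mulLp hσ (fun k => u k) j).symm)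
  rw [hasProjMinus_iff (memLp_sum_mul hσ (fun j => Lp.memLp (u j)) j), h2,
    neg_eq_of_add_eq_zero_right (b := u j - (hf j).toLp _) (by rw [← h1]; abel)]
  filter_upwards [Lp.coeFn_sub (u j) ((hf j).toLp _), (hf j).coeFn_toLp] with t h3 h4
  rw [h3, Pi.sub_apply, h4]

/-- The homogeneous row equation `u = 𝒫⁻(u σ)` has only the trivial solution in `L²`. -/
theorem row_solution_eq_zero {c : ℝ} (hc : 0 < c) {σ : ℝ → Matrix (Fin 2) (Fin 2) ℂ}
    (hσ : ∀ k j, MemLp (fun z => σ z k j) ∞) (hco : RowCoercive c σ) {u : ℝ → Fin 2 → ℂ}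
    (hu : ∀ j, MemLp (fun z => u z j) 2)
    (h : ∀ j, HasProjMinus (fun t => ∑ k, u t k * σ t k j) (fun z => u z j)) :
    ∀ᵐ z, u z = 0 := by
  set U : RowL2 := WithLp.toLp 2 fun j => (hu j).toLp _ with hU
  have hzero : U = 0 := by
    refine injective_add_proj_comp (Q := rowProj) (A := rowOp fun k j => mulLp (hσ k j))
      (fun u => by ext1 j; rw [rowProj_apply, rowProj_apply, projLower_projLower])
      (fun u v => by simp only [PiLp.inner_apply, rowProj_apply, inner_projLower]) hc
      (coercive_rowOp_mulLp hσ hco) ?_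
    ext1 j
    have h1 := (hasProjMinus_iff (memLp_sum_mul hσ hu j)).1 (h j)
    have h2 : (memLp_sum_mul hσ hu j).toLp _ = ∑ k, mulLp (hσ k j) (U k) := by
      refine Lp.ext ((MemLp.coeFn_toLp _).trans ?_)
      filter_upwards [coeFn_sum_mulLp hσ (fun k => U k) j, (hu 0).coeFn_toLp,
        (hu 1).coeFn_toLp] with t h3 h4 h5
      rw [h3, Fin.sum_univ_two, Fin.sum_univ_two, ← h4, ← h5]
    rw [h2] at h1
    have h3 : U j = -projLower (∑ k, mulLp (hσ k j) (U k)) :=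
      Lp.ext ((hu j).coeFn_toLp.trans h1)
    rw [PiLp.add_apply, rowProj_apply, rowOp_apply, PiLp.zero_apply]
    nth_rewrite 1 [h3]
    exact neg_add_cancel _
  have hj : ∀ j, ∀ᵐ z, u z j = 0 := fun j => by
    have h1 : (hu j).toLp _ = 0 := congrArg (fun v : RowL2 => v j) hzero
    exact (hu j).coeFn_toLp.symm.trans ((Lp.eq_zero_iff_ae_eq_zero).1 h1)
  filter_upwards [hj 0, hj 1] with z h0 h1
  ext j
  fin_cases j
  · exact h0
  · exact h1

/-! ### The cross and the scattering matrix in the variable `z`. -/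

lemma branch_sq (s : ℤˣ) (z : ℝ) : branch s z ^ 2 = z := by
  have hs : (((s : ℤ) : ℂ)) ^ 2 = 1 := by
    rcases Int.units_eq_one_or s with rfl | rfl <;> simp
  rw [branch, mul_pow, hs, one_mul]
  split_ifs with h
  · rw [← Complex.ofReal_pow, Real.sq_sqrt h]
  · rw [mul_pow, Complex.I_sq, ← Complex.ofReal_pow, Real.sq_sqrt (by linarith)]
    push_cast
    ring

lemma norm_branch_sq (s : ℤˣ) (z : ℝ) : ‖branch s z‖ ^ 2 = |z| := by
  rw [← norm_pow, branch_sq, Complex.norm_real, Real.norm_eq_abs]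

lemma branch_im_eq_zero_iff (s : ℤˣ) (z : ℝ) : (branch s z).im = 0 ↔ 0 ≤ z := by
  rw [branch]
  split_ifs with h
  · rcases Int.units_eq_one_or s with rfl | rfl <;> simp [h]
  · have h1 : 0 < √(-z) := Real.sqrt_pos.2 (by linarith)
    rcases Int.units_eq_one_or s with rfl | rfl <;> simp [h, h1.ne']

lemma branch_re_of_neg (s : ℤˣ) {z : ℝ} (hz : z < 0) : (branch s z).re = 0 := by
  rw [branch, if_neg (not_le.2 hz)]
  rcases Int.units_eq_one_or s with rfl | rfl <;> simp

lemma branch_neg_one (z : ℝ) : branch (-1) z = -branch 1 z := by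
  simp only [branch, Units.val_neg, Units.val_one, Int.cast_neg, Int.cast_one, neg_mul]

lemma measurable_branch (s : ℤˣ) : Measurable (branch s) := by
  unfold branch
  refine measurable_const.mul (Measurable.ite measurableSet_Ici ?_ ?_) <;> fun_prop

/-- The sheet of the cross on which a point lies. -/
def sheet (lam : ℂ) : ℤˣ := if 0 < lam.re ∨ 0 < lam.im then 1 else -1

lemma sheet_branch (s : ℤˣ) {z : ℝ} (hz : z ≠ 0) : sheet (branch s z) = s := by
  rw [sheet, branch]
  rcases lt_or_gt_of_ne hz with h | h
  · have h1 : 0 < √(-z) := Real.sqrt_pos.2 (by linarith)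
    rcases Int.units_eq_one_or s with rfl | rfl <;> simp [not_le.2 h, h1, h1.le]
  · have h1 : 0 < √z := Real.sqrt_pos.2 h
    rcases Int.units_eq_one_or s with rfl | rfl <;> simp [h.le, h1, h1.le]

/-- The sign that distinguishes the real axis from the imaginary axis of the cross. -/
def axisSign (z : ℝ) : ℂ := if 0 ≤ z then 1 else -1

lemma measurable_axisSign : Measurable axisSign :=
  Measurable.ite measurableSet_Ici measurable_const measurable_const

lemma norm_axisSign (z : ℝ) : ‖axisSign z‖ = 1 := by
  unfold axisSign
  split_ifs <;> simp

/-- The lower left entry of the scattering matrix. -/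
def scat (x : ℝ) (r : ℂ → ℂ) (s : ℤˣ) (z : ℝ) : ℂ :=
  r (branch s z) * Complex.exp (2 * Complex.I * z * x)

lemma norm_scat (x : ℝ) (r : ℂ → ℂ) (s : ℤˣ) (z : ℝ) : ‖scat x r s z‖ = ‖r (branch s z)‖ := by
  have h : (2 * Complex.I * z * x : ℂ) = ((2 * z * x : ℝ) : ℂ) * Complex.I := by
    push_cast
    ring
  rw [scat, norm_mul, h, Complex.norm_exp_ofReal_mul_I, mul_one]

lemma aestronglyMeasurable_scat (x : ℝ) {r : ℂ → ℂ} {s : ℤˣ}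
    (hr : AEStronglyMeasurable (fun z => r (branch s z))) :
    AEStronglyMeasurable (scat x r s) :=
  hr.mul (by fun_prop)

lemma S_branch (x : ℝ) (r : ℂ → ℂ) (s : ℤˣ) (z : ℝ) :
    S x r (branch s z) =
      !![axisSign z * ((‖scat x r s z‖ ^ 2 : ℝ) : ℂ), axisSign z * conj (scat x r s z);
        scat x r s z, 0] := by
  have hconj : conj (scat x r s z) =
      conj (r (branch s z)) * Complex.exp (-2 * Complex.I * z * x) := by
    rw [scat, map_mul, ← Complex.exp_conj]
    simp [Complex.conj_ofNat]
  rw [S, norm_scat, hconj, branch_sq]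
  simp only [branch_im_eq_zero_iff, axisSign]
  split_ifs <;> simp [scat]

lemma ae_bound_of_memLp_top {f : ℝ → ℂ} (hf : MemLp f ∞) : ∃ C : ℝ, 0 ≤ C ∧ ∀ᵐ z, ‖f z‖ ≤ C := by
  refine ⟨(eLpNorm f ∞ volume).toReal, ENNReal.toReal_nonneg, ?_⟩
  filter_upwards [ae_le_eLpNormEssSup (f := f) (μ := volume)] with z hz
  rw [← eLpNorm_exponent_top] at hz
  rw [← toReal_enorm]
  exact ENNReal.toReal_mono hf.2.ne hz

lemma aestronglyMeasurable_S (x : ℝ) {r : ℂ → ℂ} {s : ℤˣ}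
    (hr : AEStronglyMeasurable (fun z => r (branch s z))) (k j : Fin 2) :
    AEStronglyMeasurable (fun z => S x r (branch s z) k j) := by
  have hm := aestronglyMeasurable_scat x hr
  simp_rw [S_branch]
  fin_cases k <;> fin_cases j <;> simp
  · exact measurable_axisSign.aestronglyMeasurable.mul
      ((Complex.continuous_ofReal.comp_aestronglyMeasurable hm.norm).pow 2)
  · exact measurable_axisSign.aestronglyMeasurable.mul
      (Complex.continuous_conj.comp_aestronglyMeasurable hm)
  · exact hm
  · exact aestronglyMeasurable_const

lemma memLp_top_S (x : ℝ) {r : ℂ → ℂ} {s : ℤˣ} (hr : MemLp (fun z => r (branch s z)) ∞)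
    (k j : Fin 2) : MemLp (fun z => S x r (branch s z) k j) ∞ := by
  obtain ⟨C, hC, hb⟩ := ae_bound_of_memLp_top hr
  refine memLp_top_of_bound (aestronglyMeasurable_S x hr.1 k j) (C ^ 2 + C) ?_
  filter_upwards [hb] with z hz
  have h1 : ‖r (branch s z)‖ ^ 2 ≤ C ^ 2 := by gcongr
  rw [S_branch]
  fin_cases k <;> fin_cases j <;> simp [norm_axisSign, norm_scat] <;> nlinarith

/-! ### Coercivity of `I + S` and the integral equation on the cross. -/

/-- Completing the square turns the form into `|a|² + |b + a q̄|²`. Then `|b|² ≤ 2|b + a q̄|² +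
2M²|a|²` yields the constant; `M` may be arbitrarily large. -/
lemma le_re_form_of_hermitian {M : ℝ} (a b q : ℂ) (hq : ‖q‖ ≤ M) :
    (2 + 2 * M ^ 2)⁻¹ * (‖a‖ ^ 2 + ‖b‖ ^ 2) ≤
      (conj a * (a + (a * ((‖q‖ ^ 2 : ℝ) : ℂ) + b * q)) + conj b * (b + a * conj q)).re := by
  have h1 : (conj a * (a + (a * ((‖q‖ ^ 2 : ℝ) : ℂ) + b * q)) + conj b * (b + a * conj q)).re =
      ‖a‖ ^ 2 + ‖b + a * conj q‖ ^ 2 := by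
    simp only [Complex.sq_norm, Complex.normSq_apply, Complex.add_re, Complex.mul_re,
      Complex.conj_re, Complex.conj_im, Complex.add_im, Complex.mul_im, Complex.ofReal_re,
      Complex.ofReal_im]
    ring
  have h2 : ‖b‖ ≤ ‖b + a * conj q‖ + ‖a‖ * ‖q‖ := by
    have := norm_sub_le (b + a * conj q) (a * conj q)
    rwa [add_sub_cancel_right, norm_mul, Complex.norm_conj] at this
  have h3 : ‖b‖ ^ 2 ≤ 2 * ‖b + a * conj q‖ ^ 2 + 2 * (‖a‖ * ‖q‖) ^ 2 := by
    nlinarith [norm_nonneg b, sq_nonneg (‖b + a * conj q‖ - ‖a‖ * ‖q‖)]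
  have h4 : (‖a‖ * ‖q‖) ^ 2 ≤ M ^ 2 * ‖a‖ ^ 2 := by
    rw [mul_pow, mul_comm]
    gcongr
  rw [h1, inv_mul_le_iff₀ (by positivity)]
  nlinarith [sq_nonneg (M * ‖b + a * conj q‖), sq_nonneg ‖a‖]

/-- The two cross terms are negative conjugates of each other and drop out of the real part, leaving
`(1 - |q|²)|a|² + |b|²`. -/
lemma le_re_form_of_contractive {c : ℝ} (a b q : ℂ) (hq : c ≤ 1 - ‖q‖ ^ 2) :
    c * (‖a‖ ^ 2 + ‖b‖ ^ 2) ≤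
      (conj a * (a + (a * -((‖q‖ ^ 2 : ℝ) : ℂ) + b * q)) + conj b * (b + a * -conj q)).re := by
  have h1 : (conj a * (a + (a * -((‖q‖ ^ 2 : ℝ) : ℂ) + b * q)) +
      conj b * (b + a * -conj q)).re = (1 - ‖q‖ ^ 2) * ‖a‖ ^ 2 + ‖b‖ ^ 2 := by
    simp only [Complex.sq_norm, Complex.normSq_apply, Complex.add_re, Complex.mul_re,
      Complex.conj_re, Complex.conj_im, Complex.add_im, Complex.mul_im, Complex.ofReal_re,
      Complex.ofReal_im, Complex.neg_re, Complex.neg_im]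
    ring
  rw [h1]
  nlinarith [sq_nonneg ‖a‖, sq_nonneg ‖b‖, sq_nonneg ‖q‖]

lemma exists_rowCoercive_S (x : ℝ) {r : ℂ → ℂ} (hc : StrictlyContractive r) (s : ℤˣ)
    (hr : MemLp (fun z => r (branch s z)) ∞) :
    ∃ c : ℝ, 0 < c ∧ RowCoercive c (fun z => S x r (branch s z)) := by
  obtain ⟨M, -, hM⟩ := ae_bound_of_memLp_top hr
  obtain ⟨c₀, hc₀, hcon⟩ := hc
  refine ⟨min (2 + 2 * M ^ 2)⁻¹ (c₀ ^ 2), by positivity, ?_⟩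
  filter_upwards [hM, hcon s] with z hz hz' v
  have hnn : 0 ≤ ‖v 0‖ ^ 2 + ‖v 1‖ ^ 2 := by positivity
  simp only [Fin.sum_univ_two, S_branch]
  rcases le_or_gt 0 z with h | h
  · refine (mul_le_mul_of_nonneg_right (min_le_left _ _) hnn).trans ?_
    have := le_re_form_of_hermitian (v 0) (v 1) (scat x r s z) ((norm_scat x r s z).trans_le hz)
    simpa [axisSign, h] using this
  · refine (mul_le_mul_of_nonneg_right (min_le_right _ _) hnn).trans ?_
    have hq := hz' (branch_re_of_neg s h)
    rw [← norm_scat x] at hq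
    have := le_re_form_of_contractive (v 0) (v 1) (scat x r s z) hq
    simpa [axisSign, not_le.2 h] using this

/-- Unique solvability of `G - 𝒫⁻(G S) = F` in `L²_z`. -/
theorem integralEq_existsUnique {r : ℂ → ℂ} (hr : MemLpz ∞ r) (hc : StrictlyContractive r)
    (x : ℝ) (m : ℕ) (F : ℂ → Matrix (Fin m) (Fin 2) ℂ) (hF : MatMemL2z F) :
    ∃ G : ℂ → Matrix (Fin m) (Fin 2) ℂ, MatMemL2z G ∧ SolvesIntegralEq x r F G ∧
      ∀ G' : ℂ → Matrix (Fin m) (Fin 2) ℂ, MatMemL2z G' → SolvesIntegralEq x r F G' →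
        AEOnCross (fun lam => G' lam = G lam) := by
  have hσ : ∀ s k j, MemLp (fun z => S x r (branch s z) k j) ∞ := fun s => memLp_top_S x (hr s)
  choose c hc0 hco using fun s => exists_rowCoercive_S x hc s (hr s)
  choose u hu2 hu using fun (s : ℤˣ) (i : Fin m) => exists_row_solution (hc0 s) (hσ s) (hco s)
    (f := fun z => F (branch s z) i) (fun j => hF i j s)
  -- The two sheets are solved independently and glued. They meet only at `λ = 0`, a null set, where
  -- `sheet` makes an arbitrary choice.
  set G : ℂ → Matrix (Fin m) (Fin 2) ℂ := fun lam => Matrix.of fun i j =>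
    u (sheet lam) i (lam ^ 2).re j with hG
  have hGu : ∀ s, ∀ᵐ z : ℝ, ∀ i j, G (branch s z) i j = u s i z j := fun s => by
    filter_upwards [Measure.ae_ne volume (0 : ℝ)] with z hz i j
    simp [hG, sheet_branch s hz, branch_sq]
  have hG2 : MatMemL2z G := fun i j s => (hu2 s i j).ae_eq (by
    filter_upwards [hGu s] with z hz using (hz i j).symm)
  have hGs : SolvesIntegralEq x r F G := fun s i j => by
    refine (hu s i j).congr_ae ?_ ?_
    · filter_upwards [hGu s] with z hz
      simp [Matrix.mul_apply, hz]
    · filter_upwards [hGu s] with z hz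
      simp [hz]
  refine ⟨G, hG2, hGs, fun G' hG'2 hG's s => ?_⟩
  have hrow : ∀ i, ∀ᵐ z, (fun j => G' (branch s z) i j - G (branch s z) i j) = 0 := fun i => by
    refine row_solution_eq_zero (hc0 s) (hσ s) (hco s)
      (u := fun z j => G' (branch s z) i j - G (branch s z) i j)
      (fun j => (hG'2 i j s).sub (hG2 i j s)) fun j => ?_
    have hL : ∀ {K : ℂ → Matrix (Fin m) (Fin 2) ℂ}, MatMemL2z K →
        MemLp (fun t => (K (branch s t) * S x r (branch s t)) i j) 2 := fun hK => by
      simp only [Matrix.mul_apply]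
      exact memLp_sum_mul (hσ s) (fun k => hK i k s) j
    refine ((hG's s i j).sub (hL hG'2) (hL hG2) (hGs s i j)).congr_ae ?_ ?_
    · filter_upwards with t
      simp [Matrix.mul_apply, Fin.sum_univ_two]
      ring
    · filter_upwards with t
      simp
  filter_upwards [ae_all_iff.2 hrow] with z hz
  ext i j
  exact sub_eq_zero.1 (congrFun (hz i) j)

/-! ### The reflection coefficient and the inhomogeneity `τS`. -/

lemma reflection_branch (rp : ℝ → ℂ) (s : ℤˣ) (z : ℝ) :
    reflection rp (branch s z) = -(2 * Complex.I * branch s z) * rp z := by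
  rw [reflection, branch_sq, Complex.ofReal_re]

lemma norm_two_I_branch_mul (s : ℤˣ) (z : ℝ) : ‖2 * Complex.I * branch s z‖ ^ 2 = 4 * |z| := by
  rw [norm_mul, norm_mul, Complex.norm_I, mul_pow, norm_branch_sq]
  norm_num

lemma norm_reflection_branch (rp : ℝ → ℂ) (s : ℤˣ) (z : ℝ) :
    ‖reflection rp (branch s z)‖ = ‖2 * Complex.I * branch s z‖ * ‖rp z‖ := by
  rw [reflection_branch, norm_mul, norm_neg]

lemma aestronglyMeasurable_reflection {rp : ℝ → ℂ} (hrp : AEStronglyMeasurable rp) (s : ℤˣ) :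
    AEStronglyMeasurable (fun z => reflection rp (branch s z)) := by
  simp_rw [reflection_branch]
  exact ((measurable_branch s).const_mul (2 * Complex.I)).neg.aestronglyMeasurable.mul hrp

section ScatteringData

variable {rp rm : ℝ → ℂ} (hrm : ∀ᵐ z : ℝ, rm z = 4 * (z : ℂ) * rp z)

include hrm

/-- Since `|2iλ|² = 4|z|`, the growing factor is absorbed by `r₋ = 4z r₊`. Thus `r` is bounded or
square integrable as soon as the product `r₋ r₊` is bounded or integrable. -/
lemma ae_norm_reflection_sq (s : ℤˣ) :
    ∀ᵐ z : ℝ, ‖reflection rp (branch s z)‖ ^ 2 = ‖rm z‖ * ‖rp z‖ := by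
  filter_upwards [hrm] with z hz
  rw [norm_reflection_branch, mul_pow, norm_two_I_branch_mul, hz, norm_mul, norm_mul,
    Complex.norm_real, Real.norm_eq_abs]
  norm_num
  ring

lemma ae_norm_two_I_mul_reflection (s : ℤˣ) :
    ∀ᵐ z : ℝ, ‖2 * Complex.I * branch s z‖ * ‖reflection rp (branch s z)‖ = ‖rm z‖ := by
  filter_upwards [hrm] with z hz
  rw [norm_reflection_branch, ← mul_assoc, ← pow_two, norm_two_I_branch_mul, hz, norm_mul, norm_mul,
    Complex.norm_real, Real.norm_eq_abs]
  norm_num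

lemma memLpz_top_reflection (hp : MemH1 rp) (hm : MemH1 rm) : MemLpz ∞ (reflection rp) := by
  intro s
  obtain ⟨Cp, hCp⟩ := hp.exists_bound
  obtain ⟨Cm, hCm⟩ := hm.exists_bound
  -- The bound `1 + Cm * Cp` comes from `t ≤ 1 + t²` and avoids a square root.
  refine memLp_top_of_bound (aestronglyMeasurable_reflection hp.1.1 s) (1 + Cm * Cp) ?_
  filter_upwards [hCp, hCm, ae_norm_reflection_sq hrm s] with z h1 h2 h3
  have h4 : ‖rm z‖ * ‖rp z‖ ≤ Cm * Cp :=
    mul_le_mul h2 h1 (norm_nonneg _) ((norm_nonneg _).trans h2)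
  nlinarith [sq_nonneg (‖reflection rp (branch s z)‖ - 1)]

lemma memLpz_two_reflection (hp : MemLp rp 2) (hm : MemLp rm 2) : MemLpz 2 (reflection rp) := by
  intro s
  have hmeas := aestronglyMeasurable_reflection hp.1 s
  rw [memLp_two_iff_integrable_sq_norm hmeas]
  have h : Integrable (fun z => ‖rm z‖ * ‖rp z‖) := hm.norm.integrable_mul hp.norm
  refine h.congr ?_
  filter_upwards [ae_norm_reflection_sq hrm s] with z hz using hz.symm

/-- Each multiplication by `2iλ` meets `r` and gives modulus `|r₋|`; each division gives `|r₊|`, up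
to a bounded factor `|r|`. The other nonzero entries are controlled by `r ∈ L² ∩ L^∞`. -/
lemma memLp_tau_mul_S (hp : MemH1 rp) (hm : MemH1 rm) (j : Fin 2) (x : ℝ) (s : ℤˣ)
    (a b : Fin 2) :
    MemLp (fun z => (tau j (branch s z) * S x (reflection rp) (branch s z)) a b) 2 := by
  obtain ⟨C, hC, hCb⟩ := ae_bound_of_memLp_top (memLpz_top_reflection hrm hp hm s)
  have hr2 := memLpz_two_reflection hrm hp.1 hm.1 s
  have hS := aestronglyMeasurable_S x hr2.1
  have hlam : AEStronglyMeasurable (fun z : ℝ => 2 * Complex.I * branch s z) :=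
    ((measurable_branch s).const_mul _).aestronglyMeasurable
  have hlam' : AEStronglyMeasurable (fun z : ℝ => (2 * Complex.I * branch s z)⁻¹) :=
    ((measurable_branch s).const_mul _).inv.aestronglyMeasurable
  -- Only an inequality: at `z = 0` the inverse takes its default value `0`.
  have hdiv : ∀ z, ‖(2 * Complex.I * branch s z)⁻¹‖ * ‖reflection rp (branch s z)‖ ≤ ‖rp z‖ := by
    intro z
    rw [norm_reflection_branch, norm_inv, ← mul_assoc]
    exact mul_le_of_le_one_left (norm_nonneg _) inv_mul_le_one
  have h00 : MemLp (fun z => S x (reflection rp) (branch s z) 0 0) 2 := by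
    refine hr2.of_le_mul (c := C) (hS 0 0) ?_
    filter_upwards [hCb] with z hz
    simp only [S_branch, Matrix.of_apply, Matrix.cons_val_zero, norm_mul, norm_axisSign, one_mul]
    rw [Complex.norm_real, Real.norm_of_nonneg (by positivity), norm_scat, pow_two]
    gcongr
  have h01 : MemLp (fun z => S x (reflection rp) (branch s z) 0 1) 2 := by
    refine hr2.of_le_mul (c := 1) (hS 0 1) (Eventually.of_forall fun z => ?_)
    simp [S_branch, norm_axisSign, norm_scat]
  have h10 : MemLp (fun z => S x (reflection rp) (branch s z) 1 0) 2 := by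
    refine hr2.of_le_mul (c := 1) (hS 1 0) (Eventually.of_forall fun z => ?_)
    simp [S_branch, norm_scat]
  have h11 : ∀ z, S x (reflection rp) (branch s z) 1 1 = 0 := fun z => by simp [S_branch]
  have hl10 : MemLp (fun z => 2 * Complex.I * branch s z * S x (reflection rp) (branch s z) 1 0)
      2 := by
    refine hm.1.of_le_mul (c := 1) (hlam.mul (hS 1 0)) ?_
    filter_upwards [ae_norm_two_I_mul_reflection hrm s] with z hz
    rw [norm_mul, one_mul, ← hz]
    simp [S_branch, norm_scat]
  have hd00 : MemLp (fun z => (2 * Complex.I * branch s z)⁻¹ *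
      S x (reflection rp) (branch s z) 0 0) 2 := by
    refine hp.1.of_le_mul (c := C) (hlam'.mul (hS 0 0)) ?_
    filter_upwards [hCb] with z hz
    simp only [S_branch, Matrix.of_apply, Matrix.cons_val_zero]
    rw [norm_mul, norm_mul, norm_axisSign, one_mul, Complex.norm_real,
      Real.norm_of_nonneg (by positivity), norm_scat, pow_two, ← mul_assoc, mul_comm]
    exact mul_le_mul hz (hdiv z) (by positivity) hC
  have hd01 : MemLp (fun z => (2 * Complex.I * branch s z)⁻¹ *
      S x (reflection rp) (branch s z) 0 1) 2 := by
    refine hp.1.of_le_mul (c := 1) (hlam'.mul (hS 0 1)) (Eventually.of_forall fun z => ?_)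
    rw [norm_mul, one_mul]
    refine le_trans (le_of_eq ?_) (hdiv z)
    simp [S_branch, norm_axisSign, norm_scat]
  fin_cases j <;> fin_cases a <;> fin_cases b <;>
    simp only [tau, Matrix.mul_apply, Fin.sum_univ_two] <;> simp
  · exact h00
  · exact h01
  · exact hl10
  · simp [h11]
  · simpa [mul_assoc] using hd00
  · simpa [mul_assoc] using hd01
  · exact h10
  · simp [h11]

end ScatteringData

/-! ### The Riemann–Hilbert problem. -/

/-- As `r` is odd, `λ ↦ -λ` flips exactly the off-diagonal entries of `S`, which is conjugation by
the parity matrix. With `tau_branch`, the jump relation on the sheet `s` is the one on the sheet `1`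
multiplied from the right by `parity j s`. -/
lemma parity_mul_S (j : Fin 2) (x : ℝ) (rp : ℝ → ℂ) (s : ℤˣ) (z : ℝ) :
    parity j s * S x (reflection rp) (branch s z) =
      S x (reflection rp) (branch 1 z) * parity j s := by
  rcases Int.units_eq_one_or s with rfl | rfl
  · fin_cases j <;> simp [parity, ← Matrix.one_fin_two]
  · have h : scat x (reflection rp) (-1) z = -scat x (reflection rp) 1 z := by
      simp only [scat, reflection_branch]
      rw [branch_neg_one]
      ring
    simp only [S_branch, h]
    fin_cases j <;> simp [parity]

lemma tau_branch (j : Fin 2) (s : ℤˣ) (z : ℝ) :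
    tau j (branch s z) = tau j (branch 1 z) * parity j s := by
  rcases Int.units_eq_one_or s with rfl | rfl
  · fin_cases j <;> simp [parity, ← Matrix.one_fin_two]
  · fin_cases j <;> simp [parity, tau, branch_neg_one, inv_neg, -mul_inv_rev]

lemma parity_one (j : Fin 2) : parity j 1 = 1 := by
  fin_cases j <;> simp [parity, ← Matrix.one_fin_two]

/-- A solution of the Riemann--Hilbert problem is the Cauchy integral of its jump. -/
lemma IsRHSolution.exists_jump {j : Fin 2} {x : ℝ} {r : ℂ → ℂ}
    {Gp Gm : ℂ → Matrix (Fin 2) (Fin 2) ℂ} (h : IsRHSolution j x r Gp Gm) :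
    ∃ d g : ℝ → Matrix (Fin 2) (Fin 2) ℂ,
      (∀ a b, MemLp (fun z => d z a b) 2) ∧ (∀ a b, MemLp (fun z => g z a b) 2) ∧
      (∀ a b, HasProjMinus (fun z => d z a b) (fun z => g z a b)) ∧
      (∀ᵐ z, d z = g z * S x r (branch 1 z) + tau j (branch 1 z) * S x r (branch 1 z)) ∧
      (∀ a b ζ, 0 < ζ.im → cauchy (fun z => d z a b) ζ = Gp ζ a b) ∧
      ∀ a b ζ, ζ.im < 0 → cauchy (fun z => d z a b) ζ = Gm ζ a b := by
  obtain ⟨gp, gm, hp, hm, heq⟩ := h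
  have hlower : ∀ a b ζ, ζ.im < 0 → cauchy (fun z => (gp z - gm z) a b) ζ = Gm ζ a b :=
    fun a b ζ hζ => by
      have := cauchy_sub (hp a b).boundary_memLp (hm a b).boundary_memLp hζ.ne
      rw [(hp a b).cauchy_eq_zero_of_im_neg hζ, (hm a b).cauchy_eq_neg_of_im_neg hζ, zero_sub,
        neg_neg] at this
      exact this
  refine ⟨fun z => gp z - gm z, gm, fun a b => (hp a b).boundary_memLp.sub (hm a b).boundary_memLp,
    fun a b => (hm a b).boundary_memLp, fun a b => ?_, ?_, fun a b ζ hζ => ?_, hlower⟩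
  · filter_upwards [(hm a b).tendsto_lower] with z hz
    refine hz.congr' ?_
    filter_upwards [self_mem_nhdsWithin] with ε hε
    have hε : 0 < ε := hε
    exact (hlower a b _ (by simpa using hε)).symm
  · filter_upwards [heq 1] with z hz
    simpa [parity_one] using hz
  · have := cauchy_sub (hp a b).boundary_memLp (hm a b).boundary_memLp hζ.ne'
    rw [(hp a b).cauchy_eq_of_im_pos hζ, (hm a b).cauchy_eq_zero_of_im_pos hζ, sub_zero] at this
    exact this

/-- The Riemann--Hilbert problem has a solution. -/
lemma exists_isRHSolution {rp : ℝ → ℂ} (hr : MemLpz ∞ (reflection rp))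
    (hc : StrictlyContractive (reflection rp)) {j : Fin 2} {x : ℝ}
    (hτ : ∀ a b, MemLp (fun z =>
      (tau j (branch 1 z) * S x (reflection rp) (branch 1 z)) a b) 2) :
    ∃ Gp Gm, IsRHSolution j x (reflection rp) Gp Gm := by
  have hσ := memLp_top_S x (hr 1)
  obtain ⟨c, hc0, hco⟩ := exists_rowCoercive_S x hc 1 (hr 1)
  set T : ℝ → Matrix (Fin 2) (Fin 2) ℂ := fun z =>
    tau j (branch 1 z) * S x (reflection rp) (branch 1 z) with hT
  -- The source is `𝒫⁻(T)`, so the equation says `u = 𝒫⁻(u S + T)`: `u` is the lower boundary value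
  -- of the Cauchy integral of `u S + T`.
  choose u hu2 hu using fun a : Fin 2 => exists_row_solution hc0 hσ hco
    (f := fun z b => (-projLower ((hτ a b).toLp _) : L2) z) (fun b => Lp.memLp _)
  have hd2 : ∀ a b, MemLp (fun z => ∑ k, u a z k * S x (reflection rp) (branch 1 z) k b +
      T z a b) 2 := fun a b => (memLp_sum_mul hσ (hu2 a) b).add (hτ a b)
  have hproj : ∀ a b, (fun z => u a z b) =ᵐ[volume] ⇑(-projLower ((hd2 a b).toLp _)) := by
    intro a b
    have h1 := (hu a b).add (memLp_sum_mul hσ (hu2 a) b) (hτ a b)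
      ((hasProjMinus_iff (hτ a b)).2 EventuallyEq.rfl)
    refine EventuallyEq.trans ?_ ((hasProjMinus_iff (hd2 a b)).1 h1)
    exact Eventually.of_forall fun z => (sub_add_cancel _ _).symm
  -- A single Cauchy integral, of the jump, serves in both half planes.
  set G : ℂ → Matrix (Fin 2) (Fin 2) ℂ := fun ζ => Matrix.of fun a b =>
    cauchy ⇑((hd2 a b).toLp _) ζ
  refine ⟨G, G, fun z => Matrix.of fun a b =>
      ((hd2 a b).toLp _ - projLower ((hd2 a b).toLp _) : L2) z,
    fun z => Matrix.of fun a b => (-projLower ((hd2 a b).toLp _) : L2) z,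
    fun a b => isHardy_one_cauchy _, fun a b => isHardy_neg_one_cauchy _, fun s => ?_⟩
  have hsub : ∀ a b, ∀ᵐ z, ((hd2 a b).toLp _ - projLower ((hd2 a b).toLp _) : L2) z -
      (-projLower ((hd2 a b).toLp _) : L2) z =
      ∑ k, u a z k * S x (reflection rp) (branch 1 z) k b + T z a b := fun a b => by
    filter_upwards [Lp.coeFn_sub ((hd2 a b).toLp _) (projLower ((hd2 a b).toLp _)),
      Lp.coeFn_neg (projLower ((hd2 a b).toLp _)), (hd2 a b).coeFn_toLp] with z h1 h2 h3
    rw [h1, h2, Pi.sub_apply, Pi.neg_apply, h3]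
    ring
  have hsub' := ae_all_iff.2 fun a => ae_all_iff.2 (hsub a)
  have hproj' : ∀ᵐ z, ∀ a b, u a z b = (-projLower ((hd2 a b).toLp _) : L2) z :=
    ae_all_iff.2 fun a => ae_all_iff.2 (hproj a)
  filter_upwards [hsub', hproj'] with z h1 h2
  rw [mul_assoc, parity_mul_S, tau_branch, mul_assoc (tau j _), parity_mul_S, ← mul_assoc,
    ← mul_assoc, ← sub_mul, ← add_mul]
  congr 1
  ext a b
  simp only [Matrix.sub_apply, Matrix.add_apply, Matrix.of_apply, Matrix.mul_apply (N := S _ _ _)]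
  rw [h1 a b]
  simp only [h2, hT, Matrix.mul_apply]

/-- The term `τS` cancels in the difference of two solutions, so the difference of the lower
boundary values solves the homogeneous row equation and vanishes. The jumps then agree, and with
them their Cauchy integrals. The relation on the sheet `1` alone is enough. -/
lemma IsRHSolution.eqOn {r : ℂ → ℂ} (hr : MemLpz ∞ r) (hc : StrictlyContractive r) {j : Fin 2}
    {x : ℝ} {Gp Gm Gp' Gm' : ℂ → Matrix (Fin 2) (Fin 2) ℂ} (h : IsRHSolution j x r Gp Gm)
    (h' : IsRHSolution j x r Gp' Gm') :
    Set.EqOn Gp' Gp (halfPlane 1) ∧ Set.EqOn Gm' Gm (halfPlane (-1)) := by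
  have hσ := memLp_top_S x (hr 1)
  obtain ⟨c, hc0, hco⟩ := exists_rowCoercive_S x hc 1 (hr 1)
  obtain ⟨d, g, hd, hg, hproj, heq, hup, hlow⟩ := h.exists_jump
  obtain ⟨d', g', hd', hg', hproj', heq', hup', hlow'⟩ := h'.exists_jump
  have hrow : ∀ a, ∀ᵐ z, (fun b => g' z a b - g z a b) = 0 := fun a => by
    refine row_solution_eq_zero hc0 hσ hco (u := fun z b => g' z a b - g z a b)
      (fun b => (hg' a b).sub (hg a b)) fun b => ?_
    refine ((hproj' a b).sub (hd' a b) (hd a b) (hproj a b)).congr_ae ?_ EventuallyEq.rfl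
    filter_upwards [heq, heq'] with z h1 h2
    rw [h1, h2, Matrix.add_apply, Matrix.add_apply, add_sub_add_right_eq_sub, Matrix.mul_apply,
      Matrix.mul_apply, ← Finset.sum_sub_distrib]
    simp_rw [sub_mul]
  have hdd : ∀ a b, (fun z => d' z a b) =ᵐ[volume] fun z => d z a b := fun a b => by
    filter_upwards [heq, heq', ae_all_iff.2 hrow] with z h1 h2 h3
    have h4 : g' z = g z := by
      ext a b
      exact sub_eq_zero.1 (congrFun (h3 a) b)
    rw [h1, h2, h4]
  constructor
  · intro ζ hζ
    have hζ : 0 < ζ.im := by simpa [halfPlane] using hζ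
    ext a b
    rw [← hup a b ζ hζ, ← hup' a b ζ hζ, cauchy_congr_ae (hdd a b)]
  · intro ζ hζ
    have hζ : ζ.im < 0 := by simpa [halfPlane] using hζ
    ext a b
    rw [← hlow a b ζ hζ, ← hlow' a b ζ hζ, cauchy_congr_ae (hdd a b)]

end KaupNewell

end

theorem lemma4p5 :
    (∀ r : ℂ → ℂ, KaupNewell.MemLpz 2 r → KaupNewell.MemLpz ∞ r →
      KaupNewell.StrictlyContractive r →
      ∀ (x : ℝ) (m : ℕ) (F : ℂ → Matrix (Fin m) (Fin 2) ℂ), KaupNewell.MatMemL2z F →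
        ∃ G : ℂ → Matrix (Fin m) (Fin 2) ℂ,
          KaupNewell.MatMemL2z G ∧ KaupNewell.SolvesIntegralEq x r F G ∧
          ∀ G' : ℂ → Matrix (Fin m) (Fin 2) ℂ,
            KaupNewell.MatMemL2z G' → KaupNewell.SolvesIntegralEq x r F G' →
              KaupNewell.AEOnCross (fun lam => G' lam = G lam)) ∧
    (∀ rp rm : ℝ → ℂ,
      KaupNewell.MemH1 rp → KaupNewell.MemL21 rp → KaupNewell.MemH1 rm → KaupNewell.MemL21 rm →
      (∀ᵐ z : ℝ, rm z = 4 * (z : ℂ) * rp z) →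
      KaupNewell.StrictlyContractive (KaupNewell.reflection rp) →
      ∀ (x : ℝ) (j : Fin 2),
        ∃ Gp Gm : ℂ → Matrix (Fin 2) (Fin 2) ℂ,
          KaupNewell.IsRHSolution j x (KaupNewell.reflection rp) Gp Gm ∧
          ∀ Gp' Gm' : ℂ → Matrix (Fin 2) (Fin 2) ℂ,
            KaupNewell.IsRHSolution j x (KaupNewell.reflection rp) Gp' Gm' →
              Set.EqOn Gp' Gp (KaupNewell.halfPlane 1) ∧
              Set.EqOn Gm' Gm (KaupNewell.halfPlane (-1))) := by
  refine ⟨fun r _ hr hc x m F hF => KaupNewell.integralEq_existsUnique hr hc x m F hF,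
    fun rp rm hp _ hm _ hrm hc x j => ?_⟩
  have hr := KaupNewell.memLpz_top_reflection hrm hp hm
  obtain ⟨Gp, Gm, hG⟩ := KaupNewell.exists_isRHSolution hr hc
    (KaupNewell.memLp_tau_mul_S hrm hp hm j x 1)
  exact ⟨Gp, Gm, hG, fun Gp' Gm' hG' => hG.eqOn hr hc hG'⟩
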